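/- All graphs are finite and simple. For a graph $G$ and vertices $x,y\in V(G)$ (adjacent or not), let $G[x\to y]$ be the graph on $V(G)$ obtained from $G$ by replacing, for each $w\in N_G(x)\setminus(N_G(y)\cup\{y\})$, the edge $wx$ by the edge $wy$. A graph parameter $\mathcal P$ is a real-valued function on finite graphs. It is called feasible if for every connected graph $G$: (I) $\mathcal P(G)\le \mathcal P(G[x\to y])$ for all $x,y\in V(G)$; (II) $\mathcal P(G)<\mathcal P(G+e)$ for every new edge $e\notin E(G)$ that joins two vertices of $G$ or joins a vertex of $G$ to a new vertex. Let $P_k$ be the path with $k$ vertices; a graph is $P_k$-free if it does not contain $P_k$ as a (not necessarily induced) subgraph. Write $\vee$ for the join, $\cup$ for the disjoint union, and $mK_1$ for the edgeless graph on $m$ vertices. **Theorem.** Let $n\ge k\ge 4$ be integers, let $t=\lfloor k/2\rfloor-1$, and let $\mathcal P$ be a feasible graph parameter. Let $G$ be a connected $P_k$-free graph on $n$ vertices such that $\mathcal P(G)\ge\mathcal P(H)$ for every connected $P_k$-free graph $H$ on the same vertex set. Then there is an integer $s$ with $1\le s\le t$ such that $G$ is isomorphic to $$W_{n,k-1,s}=K_s\vee\bigl((n-k+s+1)K_1\cup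 K_{k-2s-1}\bigr).$$ -/

import Mathlib

universe u

namespace KelmansExtremal

/-- The (extended) Kelmans operation `G[x → y]`, for arbitrary vertices `x`, `y` (adjacent or not):
with `S = N(x) \ N[y]`, the edges `wx`, `w ∈ S`, are replaced by the edges `wy`, `w ∈ S`.
The vertex set is unchanged. -/
def kelmans {V : Type u} (G : SimpleGraph V) (x y : V) : SimpleGraph V :=
  SimpleGraph.fromEdgeSet
    ((G.edgeSet \ {e | ∃ w ∈ G.neighborSet x \ insert y (G.neighborSet y), e = s(w, x)}) ∪
      {e | ∃ w ∈ G.neighborSet x \ insert y (G.neighborSet y), e = s(w, y)})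

/-- `G + e` where the new edge `e` joins the vertex `v` of `G` to a new vertex `none`. -/
def addPendant {V : Type u} (G : SimpleGraph V) (v : V) : SimpleGraph (Option V) :=
  G.map Function.Embedding.some ⊔ SimpleGraph.edge (some v) none

/-- A graph parameter: a real-valued function on finite graphs. Invariance under isomorphism is
not required, so that everything below holds in particular for isomorphism invariants. -/
abbrev GraphParameter : Type (u + 1) :=
  ∀ (V : Type u) [Finite V], SimpleGraph V → ℝ

/-- Feasible graph parameters. The conditions concern connected graphs `G` only; the graph
`G[x → y]` need not be connected. The new edge in `(II)` either joins two nonadjacent vertices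
of `G` or joins a vertex of `G` to a new vertex. -/
structure Feasible (P : GraphParameter.{u}) : Prop where
  le_kelmans : ∀ (V : Type u) [Finite V] (G : SimpleGraph V), G.Connected →
    ∀ x y : V, P V G ≤ P V (kelmans G x y)
  lt_add_edge : ∀ (V : Type u) [Finite V] (G : SimpleGraph V), G.Connected →
    ∀ x y : V, x ≠ y → ¬ G.Adj x y → P V G < P V (G ⊔ SimpleGraph.edge x y)
  lt_add_pendant : ∀ (V : Type u) [Finite V] (G : SimpleGraph V), G.Connected →
    ∀ v : V, P V G < P (Option V) (addPendant G v)

/-- The join `G ∨ H`: the disjoint union together with all edges between `G` and `H`. -/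
def join {V W : Type*} (G : SimpleGraph V) (H : SimpleGraph W) : SimpleGraph (V ⊕ W) :=
  (G ⊕g H) ⊔ completeBipartiteGraph V W

/-- `W_{n,m,s} = K_s ∨ ((n - m + s) K_1 ∪ K_{m - 2s})`, for `2s ≤ m ≤ n`. -/
def graphW (n m s : ℕ) : SimpleGraph (Fin s ⊕ (Fin (n - m + s) ⊕ Fin (m - 2 * s))) :=
  join (⊤ : SimpleGraph (Fin s))
    ((⊥ : SimpleGraph (Fin (n - m + s))) ⊕g (⊤ : SimpleGraph (Fin (m - 2 * s))))

/-- `G` is a connected `P_k`-free graph (`P_k` being the path with `k` vertices, excluded as a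
not necessarily induced subgraph) whose value of `P` is maximum among all connected `P_k`-free
graphs on its vertex set. -/
def IsExtremal (P : GraphParameter.{u}) (k : ℕ) {V : Type u} [Finite V]
    (G : SimpleGraph V) : Prop :=
  (G.Connected ∧ (SimpleGraph.pathGraph k).Free G) ∧
    ∀ H : SimpleGraph V, H.Connected → (SimpleGraph.pathGraph k).Free H → P V H ≤ P V G

end KelmansExtremal

/-! The parameter enters only through `IsSaturated`. If Kelmans operations through connected graphs
lead from the extremal $G$ to $H$, then $H$ has no proper $P_k$-free supergraph, since an added edge
would strictly raise the parameter. Operations on nonadjacent pairs may create long paths, but this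
is harmless: it is enough that the last graph lies below a $P_k$-free one.

Fix an injective ranking `ρ`. Suppose $x,y$ are adjacent with `ρ y < ρ x` and some neighbour of $x$
other than $y$ is not adjacent to $y$. Then $G[x\to y]$ is again saturated (`hasPath_of_kelmans`)
and has smaller `edgeWeight`, so by induction it is a `wGraph`. Either the operation merely swaps
$x$ and $y$, and $G$ is isomorphic to that graph, or $x$ and $y$ both have private neighbours, and
then $G$ already contains $P_k$ (`hasPath_of_kelmans_eq_wGraph`).

There remain the nested graphs, which are the comparability graphs of rooted trees
(`IsNested.exists_wGraph`). Delete the dominating vertices $D_0$. Let $S$ be the tree of a deepest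
remaining vertex and $O$ the union of the other trees. Inductively $S$ is turned into a subgraph of
a small `wGraph D₁ B₁`. The edges inside $O$ are then redirected to a set $Y\subseteq S$ containing
$D_1$, with at least one vertex for each depth below the maximum (`exists_reach_strip`). The result
lies below the `wGraph` with centre $D_0\cup Y$, whose size is bounded because long paths in $S$ and
$O$ combine to a path in $G$. If $Y\ne\emptyset$, an edge is missing, contrary to saturation. If
$Y=\emptyset$, then $G$ itself lies below a $P_k$-free `wGraph` and equals it. -/

namespace KelmansExtremal

variable {V : Type u}

/-! ### Adjacency after a Kelmans operation -/

section Kelmans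

variable {G : SimpleGraph V} {x y : V}

theorem kelmans_adj (a b : V) : (kelmans G x y).Adj a b ↔ a ≠ b ∧
    ((G.Adj a b ∧ ¬ ((b = x ∧ G.Adj x a ∧ a ≠ y ∧ ¬ G.Adj y a) ∨
        (a = x ∧ G.Adj x b ∧ b ≠ y ∧ ¬ G.Adj y b))) ∨
      ((b = y ∧ G.Adj x a ∧ a ≠ y ∧ ¬ G.Adj y a) ∨
        (a = y ∧ G.Adj x b ∧ b ≠ y ∧ ¬ G.Adj y b))) := by
  unfold kelmans
  simp only [SimpleGraph.fromEdgeSet_adj, Set.mem_union, Set.mem_sdiff, SimpleGraph.mem_edgeSet,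
    Set.mem_ofPred_eq, Set.mem_insert_iff, SimpleGraph.mem_neighborSet, Sym2.eq_iff]
  grind [SimpleGraph.adj_comm]

theorem kelmans_adj_of_ne {a b : V} (ha : a ≠ x) (ha' : a ≠ y) (hb : b ≠ x) (hb' : b ≠ y) :
    (kelmans G x y).Adj a b ↔ G.Adj a b := by
  rw [kelmans_adj]
  grind [SimpleGraph.Adj.ne]

theorem kelmans_adj_target (hxy : x ≠ y) {a : V} (ha : a ≠ y) :
    (kelmans G x y).Adj y a ↔ G.Adj y a ∨ G.Adj x a := by
  rw [kelmans_adj]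
  grind [SimpleGraph.Adj.ne]

theorem kelmans_adj_source (hxy : x ≠ y) {a : V} (ha : a ≠ x) (ha' : a ≠ y) :
    (kelmans G x y).Adj x a ↔ G.Adj x a ∧ G.Adj y a := by
  rw [kelmans_adj]
  grind [SimpleGraph.Adj.ne]

theorem kelmans_adj_self (hxy : x ≠ y) : (kelmans G x y).Adj x y ↔ G.Adj x y := by
  rw [kelmans_adj]
  grind [SimpleGraph.Adj.ne, SimpleGraph.adj_comm]

theorem adj_of_kelmans_adj {a b : V} (h : (kelmans G x y).Adj a b) (ha : a ≠ y) (hb : b ≠ y) :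
    G.Adj a b := by
  rw [kelmans_adj] at h
  grind

end Kelmans

/-! ### Paths as vertex lists -/

section Paths

/-- `G` contains a path with `k` vertices, given by the list of its vertices. -/
def HasPath (G : SimpleGraph V) (k : ℕ) : Prop :=
  ∃ l : List V, l.IsChain G.Adj ∧ l.Nodup ∧ l.length = k

variable {G : SimpleGraph V}

theorem HasPath.of_le_length {l : List V} (hl : l.IsChain G.Adj) (hn : l.Nodup) {k : ℕ}
    (hk : k ≤ l.length) : HasPath G k :=
  ⟨l.take k, hl.take k, hn.sublist (List.take_sublist k l), by simpa using hk⟩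

theorem pathGraph_isContained_iff (k : ℕ) :
    (SimpleGraph.pathGraph k).IsContained G ↔ HasPath G k := by
  constructor
  · rintro ⟨f⟩
    refine ⟨List.ofFn f, ?_, List.nodup_ofFn.2 f.injective, by simp⟩
    rw [List.isChain_iff_getElem]
    intro i hi
    simp only [List.getElem_ofFn]
    apply f.toHom.map_adj
    simp [SimpleGraph.pathGraph_adj]
  · rintro ⟨l, hl, hn, rfl⟩
    refine ⟨⟨⟨fun i => l[i], ?_⟩, ?_⟩⟩
    · intro a b hab
      rw [List.isChain_iff_getElem] at hl
      rcases SimpleGraph.pathGraph_adj.1 hab with h | h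
      · have := hl a.1 (by omega)
        simpa [h] using this
      · have := hl b.1 (by omega)
        simpa [h] using this.symm
    · intro a b hab
      exact Fin.ext ((hn.getElem_inj_iff).1 hab)

theorem HasPath.mono {H : SimpleGraph V} (h : G ≤ H) {k : ℕ} : HasPath G k → HasPath H k := by
  rintro ⟨l, hl, hn, hk⟩
  exact ⟨l, hl.imp (fun _ _ hab => h hab), hn, hk⟩

theorem HasPath.le_card [Finite V] {k : ℕ} : HasPath G k → k ≤ Nat.card V := by
  rintro ⟨l, hl, hn, rfl⟩
  have := Fintype.ofFinite V
  simpa using hn.length_le_card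

theorem isChain_toList_of_clique {s : Finset V} (hs : ∀ a ∈ s, ∀ b ∈ s, a ≠ b → G.Adj a b) :
    s.toList.IsChain G.Adj := by
  apply List.Pairwise.isChain
  have := s.nodup_toList
  rw [List.Nodup] at this
  refine List.Pairwise.imp_of_mem ?_ this
  intro a b ha hb hab
  exact hs a (by simpa using ha) b (by simpa using hb) hab

/-- Vertices adjacent to all others extend a path by two vertices each, as long as vertices are
available. -/
theorem exists_path_extend [Finite V] [DecidableEq V] (U : Finset V)
    (hU : ∀ u ∈ U, ∀ v, v ≠ u → G.Adj u v) :
    ∀ l : List V, l.IsChain G.Adj → l.Nodup → l ≠ [] → (∀ u ∈ U, u ∉ l) → ∀ k,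
      k ≤ Nat.card V → k ≤ l.length + 2 * U.card → HasPath G k := by
  have := Fintype.ofFinite V
  induction U using Finset.induction_on with
  | empty =>
    intro l hl hn _ _ k _ hk
    exact HasPath.of_le_length hl hn (by simpa using hk)
  | insert u U hu ih =>
    intro l hl hn hne hd k hkn hk
    have hul : u ∉ l := hd u (by simp)
    rw [Finset.card_insert_of_notMem hu] at hk
    by_cases hw : ∃ w, w ∉ l ∧ w ∉ insert u U
    · obtain ⟨w, hwl, hwU⟩ := hw
      have hwu : w ≠ u := fun h => hwU (by simp [h])
      refine ih (fun a ha => hU a (by simp [ha])) (l ++ [u, w]) ?_ ?_ (by simp) ?_ k hkn ?_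
      · rw [List.isChain_append]
        refine ⟨hl, by simpa using hU u (by simp) w hwu, ?_⟩
        intro a ha b hb
        have hb' : u = b := by simpa using hb
        subst hb'
        refine (hU u (by simp) a ?_).symm
        rintro rfl
        exact hul (List.mem_of_getLast? ha)
      · rw [List.nodup_append]
        refine ⟨hn, by simpa using hwu.symm, ?_⟩
        rintro a ha b hb rfl
        simp only [List.mem_cons, List.not_mem_nil, or_false] at hb
        rcases hb with rfl | rfl <;> contradiction
      · intro a ha hal
        simp only [List.mem_append, List.mem_cons, List.not_mem_nil, or_false] at hal
        rcases hal with h | rfl | rfl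
        · exact hd a (by simp [ha]) h
        · exact hu ha
        · exact hwU (by simp [ha])
      · simp only [List.length_append, List.length_cons, List.length_nil]
        omega
    · push Not at hw
      -- No fresh vertex is left, so `l` and the unused dominating vertices cover `V`. Gaining one
      -- vertex per step now suffices, because `k ≤ Nat.card V`.
      have hcard : Nat.card V ≤ l.length + (U.card + 1) := by
        have h1 : (Finset.univ : Finset V) ⊆ l.toFinset ∪ insert u U := by
          intro w _
          by_cases h : w ∈ l
          · simp [h]
          · exact Finset.mem_union_right _ (hw w h)
        have h2 := Finset.card_le_card h1
        have h3 := Finset.card_union_le l.toFinset (insert u U)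
        have h4 := l.toFinset_card_le
        rw [Finset.card_insert_of_notMem hu] at h3
        rw [Nat.card_eq_fintype_card]
        simp only [Finset.card_univ] at h2
        omega
      refine ih (fun a ha => hU a (by simp [ha])) (l ++ [u]) ?_ ?_ (by simp) ?_ k hkn ?_
      · rw [List.isChain_append]
        refine ⟨hl, by simp, ?_⟩
        intro a ha b hb
        have hb' : u = b := by simpa using hb
        subst hb'
        refine (hU u (by simp) a ?_).symm
        rintro rfl
        exact hul (List.mem_of_getLast? ha)
      · rw [List.nodup_append]
        refine ⟨hn, by simp, ?_⟩
        rintro a ha b hb rfl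
        simp only [List.mem_cons, List.not_mem_nil, or_false] at hb
        subst hb
        contradiction
      · intro a ha hal
        simp only [List.mem_append, List.mem_cons, List.not_mem_nil, or_false] at hal
        rcases hal with h | rfl
        · exact hd a (by simp [ha]) h
        · exact hu ha
      · simp only [List.length_append, List.length_cons, List.length_nil]
        omega

end Paths

/-! ### Kelmans operations along an edge create no longer paths -/

section PathsUnderKelmans

variable {G : SimpleGraph V} {x y : V}

theorem isChain_of_kelmans {l : List V} (hl : l.IsChain (kelmans G x y).Adj) (hy : y ∉ l) :
    l.IsChain G.Adj := by
  rw [List.isChain_iff_getElem] at hl ⊢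
  intro i hi
  have h1 : l[i] ∈ l := List.getElem_mem _
  have h2 : l[i + 1] ∈ l := List.getElem_mem _
  exact adj_of_kelmans_adj (hl i hi) (fun h => hy (h ▸ h1)) (fun h => hy (h ▸ h2))

/-- Kelmans' operation along an edge creates no longer path: the case in which the source `x` is
not on the path. -/
theorem hasPath_of_kelmans_notMem (hxy : G.Adj x y) {A B : List V}
    (hl : (A ++ y :: B).IsChain (kelmans G x y).Adj) (hn : (A ++ y :: B).Nodup)
    (hx : x ∉ A ++ y :: B) : HasPath G (A ++ y :: B).length := by
  have hyA : y ∉ A := by grind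
  have hyB : y ∉ B := by grind
  rw [List.isChain_append, List.isChain_cons] at hl
  obtain ⟨hA, ⟨hyb, hB⟩, hAy⟩ := hl
  replace hA := isChain_of_kelmans hA hyA
  replace hB := isChain_of_kelmans hB hyB
  have hb : (∀ b ∈ B.head?, G.Adj y b) ∨ (∀ b ∈ B.head?, G.Adj x b) := by
    cases hh : B.head? with
    | none => simp
    | some b =>
      have hbB : b ∈ B := List.mem_of_head? hh
      simpa using (kelmans_adj_target hxy.ne (by grind)).1 (hyb b hh)
  have ha : (∀ a ∈ A.getLast?, G.Adj a y) ∨ (∀ a ∈ A.getLast?, G.Adj a x) := by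
    cases hh : A.getLast? with
    | none => simp
    | some a =>
      have haA : a ∈ A := List.mem_of_getLast? hh
      have := (kelmans_adj_target hxy.ne (by grind)).1 (hAy a hh y (by simp)).symm
      simpa [G.adj_comm a] using this
  -- `M` replaces `y`. Each neighbour of `y` on the new path is an old neighbour of `x` or of `y`,
  -- and the edge `xy` bridges the mixed cases. The surplus vertex is cut off by
  -- `HasPath.of_le_length`.
  have key : ∀ M : List V, M.IsChain G.Adj → (A ++ (M ++ B)).Nodup → 1 ≤ M.length →
      (∀ a ∈ A.getLast?, ∀ b ∈ (M ++ B).head?, G.Adj a b) →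
      (∀ a ∈ M.getLast?, ∀ b ∈ B.head?, G.Adj a b) → HasPath G (A ++ y :: B).length := by
    intro M hM hMn hM1 h1 h2
    refine HasPath.of_le_length (l := A ++ (M ++ B)) ?_ hMn (by simp; omega)
    rw [List.isChain_append, List.isChain_append]
    exact ⟨hA, ⟨hM, hB, h2⟩, h1⟩
  rcases ha with ha | ha <;> rcases hb with hb | hb
  · exact key [y] (by simp) (by simpa using hn) (by simp) (by simpa using ha) (by simpa using hb)
  · exact key [y, x] (by simpa using hxy.symm) (by grind) (by simp) (by simpa using ha)
      (by simpa using hb)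
  · exact key [x, y] (by simpa using hxy) (by grind) (by simp) (by simpa using ha)
      (by simpa using hb)
  · exact key [x] (by simp) (by grind) (by simp) (by simpa using ha) (by simpa using hb)

/-- Kelmans' operation along an edge creates no longer path: the case in which the path visits
the target `y` before the source `x`. -/
theorem hasPath_of_kelmans_mem (hxy : G.Adj x y) {A B C : List V}
    (hl : (A ++ y :: (B ++ x :: C)).IsChain (kelmans G x y).Adj)
    (hn : (A ++ y :: (B ++ x :: C)).Nodup) : HasPath G (A ++ y :: (B ++ x :: C)).length := by
  have hyA : y ∉ A := by grind
  have hyB : y ∉ B := by grind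
  have hyC : y ∉ C := by grind
  have hxA : x ∉ A := by grind
  have hxB : x ∉ B := by grind
  have hxC : x ∉ C := by grind
  rw [List.isChain_append, List.isChain_cons, List.isChain_append, List.isChain_cons] at hl
  obtain ⟨hA, ⟨hyb, hB, ⟨hxc, hC⟩, hBx⟩, hAy⟩ := hl
  replace hA := isChain_of_kelmans hA hyA
  replace hB := isChain_of_kelmans hB hyB
  replace hC := isChain_of_kelmans hC hyC
  have hc : ∀ c ∈ C.head?, G.Adj x c ∧ G.Adj y c := by
    intro c hh
    have : c ∈ C := List.mem_of_head? hh
    exact (kelmans_adj_source hxy.ne (by grind) (by grind)).1 (hxc c hh)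
  have hbx : ∀ b ∈ B.getLast?, G.Adj b x ∧ G.Adj b y := by
    intro b hh
    have : b ∈ B := List.mem_of_getLast? hh
    have := (kelmans_adj_source hxy.ne (by grind) (by grind)).1 (hBx b hh x (by simp)).symm
    exact ⟨this.1.symm, this.2.symm⟩
  have ha : (∀ a ∈ A.getLast?, G.Adj a y) ∨ (∀ a ∈ A.getLast?, G.Adj a x) := by
    cases hh : A.getLast? with
    | none => simp
    | some a =>
      have haA : a ∈ A := List.mem_of_getLast? hh
      have := (kelmans_adj_target hxy.ne (by grind)).1 (hAy a hh y (by simp)).symm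
      simpa [G.adj_comm a] using this
  have hb : (∀ b ∈ B.head?, G.Adj y b) ∨ (∀ b ∈ B.head?, G.Adj x b) := by
    cases hh : B.head? with
    | none => simp
    | some b =>
      have hbB : b ∈ B := List.mem_of_head? hh
      have := (kelmans_adj_target hxy.ne (by grind)).1 (hyb b (by
        rw [List.head?_append, hh]; simp))
      simpa using this
  -- Swapping `x` and `y` and reversing `B` repairs the path: the path neighbours of `x`, namely the
  -- last vertex of `B` and the first of `C`, are old neighbours of both `x` and `y`.
  have key : ∀ (p q : V) (M : List V), ((p = x ∧ q = y) ∨ (p = y ∧ q = x)) →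
      (M = B ∨ M = B.reverse) →
      (∀ a ∈ A.getLast?, G.Adj a p) → (∀ b ∈ M.head?, G.Adj p b) →
      (∀ b ∈ M.getLast?, G.Adj b q) → HasPath G (A ++ y :: (B ++ x :: C)).length := by
    intro p q M hpq hM h1 h2 h3
    have hpq' : G.Adj p q := by
      rcases hpq with ⟨rfl, rfl⟩ | ⟨rfl, rfl⟩
      · exact hxy
      · exact hxy.symm
    have hqc : ∀ c ∈ C.head?, G.Adj q c := by
      rcases hpq with ⟨rfl, rfl⟩ | ⟨rfl, rfl⟩
      · exact fun c h => (hc c h).2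
      · exact fun c h => (hc c h).1
    have hMc : M.IsChain G.Adj := by
      rcases hM with rfl | rfl
      · exact hB
      · rw [List.isChain_reverse]
        exact hB.imp fun _ _ h => h.symm
    have hperm : M.Perm B := by
      rcases hM with rfl | rfl
      · exact List.Perm.refl _
      · exact List.reverse_perm _
    have hperm' : (A ++ p :: (M ++ q :: C)).Perm (A ++ y :: (B ++ x :: C)) := by
      refine List.Perm.append_left A ?_
      have h : (p :: (M ++ q :: C)).Perm (p :: q :: (B ++ C)) :=
        List.Perm.cons p (List.perm_middle.trans ((hperm.append_right C).cons q))
      have h' : (y :: (B ++ x :: C)).Perm (y :: x :: (B ++ C)) :=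
        List.Perm.cons y List.perm_middle
      refine h.trans (List.Perm.trans ?_ h'.symm)
      rcases hpq with ⟨rfl, rfl⟩ | ⟨rfl, rfl⟩
      · exact List.Perm.swap _ _ _
      · exact List.Perm.refl _
    refine ⟨A ++ p :: (M ++ q :: C), ?_, hperm'.nodup_iff.2 hn, hperm'.length_eq⟩
    rw [List.isChain_append, List.isChain_cons, List.isChain_append, List.isChain_cons]
    refine ⟨hA, ⟨?_, hMc, ⟨hqc, hC⟩, by simpa using h3⟩, by simpa using h1⟩
    intro b hb
    cases hh : M.head? with
    | none =>
      rw [List.head?_append, hh] at hb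
      have : q = b := by simpa using hb
      exact this ▸ hpq'
    | some m =>
      rw [List.head?_append, hh] at hb
      have : m = b := by simpa using hb
      exact this ▸ h2 m hh
  have hr : ∀ p, (∀ b ∈ B.getLast?, G.Adj b p) → ∀ b ∈ B.reverse.head?, G.Adj p b := by
    intro p h b hb
    rw [List.head?_reverse] at hb
    exact (h b hb).symm
  have hr' : ∀ p, (∀ b ∈ B.head?, G.Adj p b) → ∀ b ∈ B.reverse.getLast?, G.Adj b p := by
    intro p h b hb
    rw [List.getLast?_reverse] at hb
    exact (h b hb).symm
  rcases ha with ha | ha <;> rcases hb with hb | hb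
  · exact key y x B (by simp) (by simp) ha hb fun b h => (hbx b h).1
  · exact key y x B.reverse (by simp) (by simp) ha (hr y fun b h => (hbx b h).2) (hr' x hb)
  · exact key x y B.reverse (by simp) (by simp) ha (hr x fun b h => (hbx b h).1) (hr' y hb)
  · exact key x y B (by simp) (by simp) ha hb fun b h => (hbx b h).2

theorem hasPath_of_kelmans (hxy : G.Adj x y) {k : ℕ} : HasPath (kelmans G x y) k → HasPath G k := by
  rintro ⟨l, hl, hn, rfl⟩
  by_cases hy : y ∈ l
  swap
  · exact ⟨l, isChain_of_kelmans hl hy, hn, rfl⟩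
  by_cases hx : x ∈ l
  swap
  · obtain ⟨A, B, rfl⟩ := List.append_of_mem hy
    exact hasPath_of_kelmans_notMem hxy hl hn hx
  obtain ⟨A, B, rfl⟩ := List.append_of_mem hy
  rcases List.mem_append.1 hx with h | h
  · obtain ⟨A₁, A₂, rfl⟩ := List.append_of_mem h
    have e : (A₁ ++ x :: A₂ ++ y :: B).reverse
        = B.reverse ++ y :: (A₂.reverse ++ x :: A₁.reverse) := by simp
    rw [← List.length_reverse, e]
    apply hasPath_of_kelmans_mem hxy
    · rw [← e, List.isChain_reverse]
      exact hl.imp fun _ _ h => h.symm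
    · rw [← e, List.nodup_reverse]
      exact hn
  · have h' : x ∈ B := by
      rcases List.mem_cons.1 h with h | h
      · exact absurd h hxy.ne
      · exact h
    obtain ⟨B₁, C, rfl⟩ := List.append_of_mem h'
    exact hasPath_of_kelmans_mem hxy hl hn

end PathsUnderKelmans

/-! ### Reachability, target graphs and stripping of edges -/

/-- A Kelmans operation on two distinct vertices whose result is connected. -/
def Step (G H : SimpleGraph V) : Prop :=
  H.Connected ∧ ∃ x y, x ≠ y ∧ H = kelmans G x y

/-- `H` is obtained from `G` by Kelmans operations through connected graphs. -/
def Reach : SimpleGraph V → SimpleGraph V → Prop :=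
  Relation.ReflTransGen Step

/-- The graph in which the vertices of `D` are adjacent to all others, `B` is a clique and the
vertices outside `D ∪ B` are independent. -/
def wGraph (D B : Finset V) : SimpleGraph V where
  Adj a b := a ≠ b ∧ (a ∈ D ∨ b ∈ D ∨ (a ∈ B ∧ b ∈ B))
  symm := ⟨fun a b h => by grind⟩
  loopless := ⟨fun a h => h.1 rfl⟩

theorem wGraph_adj {D B : Finset V} {a b : V} :
    (wGraph D B).Adj a b ↔ a ≠ b ∧ (a ∈ D ∨ b ∈ D ∨ (a ∈ B ∧ b ∈ B)) := Iff.rfl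

theorem connected_of_dominating {G : SimpleGraph V} {u : V} (hu : ∀ v, v ≠ u → G.Adj u v) :
    G.Connected := by
  have : Nonempty V := ⟨u⟩
  rw [SimpleGraph.connected_iff_exists_forall_reachable]
  refine ⟨u, fun v => ?_⟩
  by_cases h : v = u
  · rw [h]
  · exact (hu v h).reachable

theorem kelmans_dominating {G : SimpleGraph V} {u x y : V} (hu : ∀ v, v ≠ u → G.Adj u v)
    (hxy : x ≠ y) (hx : x ≠ u) (hy : y ≠ u) : ∀ v, v ≠ u → (kelmans G x y).Adj u v := by
  intro v hv
  by_cases h1 : v = x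
  · subst h1
    exact ((kelmans_adj_source hxy hx.symm hy.symm).2 ⟨(hu v hv).symm, (hu y hy).symm⟩).symm
  · by_cases h2 : v = y
    · subst h2
      exact ((kelmans_adj_target hxy hy.symm).2 (Or.inl (hu v hv).symm)).symm
    · exact (kelmans_adj_of_ne hx.symm hy.symm h1 h2).2 (hu v hv)

/-- The vertices of `O`, properly coloured by `ℓ`, can be stripped of all edges within `O` by
applying Kelmans operations towards the vertices `y j`, one for each colour `j`. -/
theorem exists_reach_strip [Finite V] {D B : Finset V} {O : Set V} {u : V} (huO : u ∉ O)
    {ℓ : V → ℕ} {r : ℕ} {y : ℕ → V} (hyD : ∀ j < r, y j ∈ D) (hyO : ∀ j < r, y j ∉ O)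
    (hyu : ∀ j < r, y j ≠ u) (hyi : ∀ i < r, ∀ j < r, y i = y j → i = j)
    (hℓr : ∀ a ∈ O, ℓ a ≤ r) :
    ∀ (m : ℕ) (G : SimpleGraph V),
      {p : V × V | p.1 ∈ O ∧ p.2 ∈ O ∧ G.Adj p.1 p.2}.ncard = m →
      (∀ v, v ≠ u → G.Adj u v) →
      (∀ a b, G.Adj a b → (wGraph D B).Adj a b ∨ (a ∈ O ∧ b ∈ O)) →
      (∀ a ∈ O, ∀ b ∈ O, G.Adj a b → ℓ a ≠ ℓ b) →
      (∀ w ∈ O, ∀ a ∈ O, ∀ b ∈ O, G.Adj w a → G.Adj w b → ℓ a = ℓ b → ℓ a < ℓ w → a = b) →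
      (∀ w ∈ O, ∀ j < r, G.Adj w (y j) → ℓ w ≠ j ∧ ∀ a ∈ O, G.Adj w a → ℓ a ≠ j) →
      ∃ H, Reach G H ∧ H ≤ wGraph D B ∧ ∀ w ∈ O, ∀ j < r, H.Adj w (y j) → ℓ w ≠ j := by
  intro m
  induction m using Nat.strong_induction_on with
  | _ m ih =>
  intro G hm hu hW hcol huniq hinv
  by_cases hE : ∃ x, x ∈ O ∧ ∃ w ∈ O, G.Adj x w
  swap
  · push Not at hE
    refine ⟨G, Relation.ReflTransGen.refl, ?_, fun w hw j hj h => (hinv w hw j hj h).1⟩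
    intro a b hab
    rcases hW a b hab with h | ⟨ha, hb⟩
    · exact h
    · exact absurd hab (hE a ha b hb)
  -- Take `x` of least colour `j` among the vertices with an edge in `O`. By the last invariant
  -- neither `x` nor its neighbours in `O` are adjacent to `y j`, so the operation towards `y j`
  -- removes every edge from `x` into `O`.
  obtain ⟨x, ⟨hxO, w₀, hw₀, hxw₀⟩, hmin⟩ :
      ∃ x, (x ∈ O ∧ ∃ w ∈ O, G.Adj x w) ∧ ∀ z, (z ∈ O ∧ ∃ w ∈ O, G.Adj z w) → ℓ x ≤ ℓ z := by
    obtain ⟨x, hx, h⟩ := Set.exists_min_image {x | x ∈ O ∧ ∃ w ∈ O, G.Adj x w} ℓ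
      (Set.toFinite _) hE
    exact ⟨x, hx, h⟩
  have hlt : ∀ w ∈ O, G.Adj x w → ℓ x < ℓ w := fun w hw h =>
    lt_of_le_of_ne (hmin w ⟨hw, x, hxO, h.symm⟩) (hcol x hxO w hw h)
  set j := ℓ x with hj
  have hjr : j < r := lt_of_lt_of_le (hlt w₀ hw₀ hxw₀) (hℓr w₀ hw₀)
  have hxy : x ≠ y j := fun h => hyO j hjr (h ▸ hxO)
  have hxu : x ≠ u := fun h => huO (h ▸ hxO)
  have hne : ∀ w ∈ O, w ≠ y j := fun w hw h => hyO j hjr (h ▸ hw)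
  have hxy' : ¬ G.Adj x (y j) := fun h => (hinv x hxO j hjr h).1 hj.symm
  have hsub : ∀ a ∈ O, ∀ b ∈ O, (kelmans G x (y j)).Adj a b → G.Adj a b := fun a ha b hb h =>
    adj_of_kelmans_adj h (hne a ha) (hne b hb)
  have hiso : ∀ w ∈ O, ¬ (kelmans G x (y j)).Adj x w := by
    intro w hw h
    have hwx : w ≠ x := h.ne'
    obtain ⟨h1, h2⟩ := (kelmans_adj_source hxy hwx (hne w hw)).1 h
    exact (hinv w hw j hjr h2.symm).2 x hxO h1.symm rfl
  have hu' := kelmans_dominating hu hxy hxu (hyu j hjr)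
  have hlt' : {p : V × V | p.1 ∈ O ∧ p.2 ∈ O ∧ (kelmans G x (y j)).Adj p.1 p.2}.ncard < m := by
    rw [← hm]
    apply Set.ncard_lt_ncard _ (Set.toFinite _)
    refine ⟨fun p hp => ⟨hp.1, hp.2.1, hsub _ hp.1 _ hp.2.1 hp.2.2⟩, fun h => ?_⟩
    have := @h (x, w₀) ⟨hxO, hw₀, hxw₀⟩
    exact hiso w₀ hw₀ this.2.2
  have hW' : ∀ a b, (kelmans G x (y j)).Adj a b →
      (wGraph D B).Adj a b ∨ (a ∈ O ∧ b ∈ O) := by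
    intro a b hab
    by_cases ha : a = y j
    · exact Or.inl ⟨hab.ne, Or.inl (ha ▸ hyD j hjr)⟩
    by_cases hb : b = y j
    · exact Or.inl ⟨hab.ne, Or.inr (Or.inl (hb ▸ hyD j hjr))⟩
    exact hW a b (adj_of_kelmans_adj hab ha hb)
  have hinv' : ∀ w ∈ O, ∀ i < r, (kelmans G x (y j)).Adj w (y i) →
      ℓ w ≠ i ∧ ∀ a ∈ O, (kelmans G x (y j)).Adj w a → ℓ a ≠ i := by
    intro w hw i hi hwi
    by_cases hij : i = j
    · rw [hij] at hwi ⊢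
      by_cases hwx : w = x
      · rw [hwx] at hwi
        exact absurd ((kelmans_adj_self hxy).1 hwi) hxy'
      rcases (kelmans_adj_target hxy (hne w hw)).1 hwi.symm with h | h
      · exact ⟨(hinv w hw _ hjr h.symm).1, fun a ha hwa =>
          (hinv w hw _ hjr h.symm).2 a ha (hsub w hw a ha hwa)⟩
      -- A neighbour `w` of `x` has just gained `y j`. By uniqueness its only neighbour in `O` of
      -- colour `j` was `x`, which it has lost.
      · refine ⟨(hlt w hw h).ne', fun a ha hwa hℓ => ?_⟩
        have := huniq w hw a ha x hxO (hsub w hw a ha hwa) h.symm hℓ (hℓ ▸ hlt w hw h)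
        exact hiso w hw (this ▸ hwa.symm)
    · have hyne : y i ≠ y j := fun h => hij (hyi i hi j hjr h)
      have := adj_of_kelmans_adj hwi (hne w hw) hyne
      exact ⟨(hinv w hw i hi this).1, fun a ha hwa =>
        (hinv w hw i hi this).2 a ha (hsub w hw a ha hwa)⟩
  obtain ⟨H, hH1, hH2, hH3⟩ := ih _ hlt' (kelmans G x (y j)) rfl hu' hW'
    (fun a ha b hb h => hcol a ha b hb (hsub a ha b hb h))
    (fun w hw a ha b hb h1 h2 => huniq w hw a ha b hb (hsub _ hw _ ha h1) (hsub _ hw _ hb h2))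
    hinv'
  exact ⟨H, Relation.ReflTransGen.head ⟨connected_of_dominating hu', x, y j, hxy, rfl⟩ hH1,
    hH2, hH3⟩

/-! ### Kelmans operations inside a module -/

/-- The graph `G` with its restriction to `S` replaced by `H`. -/
def glue (G : SimpleGraph V) (S : Set V) (H : SimpleGraph S) : SimpleGraph V where
  Adj a b := (∃ (ha : a ∈ S) (hb : b ∈ S), H.Adj ⟨a, ha⟩ ⟨b, hb⟩) ∨
    (¬ (a ∈ S ∧ b ∈ S) ∧ G.Adj a b)
  symm := ⟨by
    rintro a b (⟨ha, hb, h⟩ | ⟨h1, h2⟩)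
    · exact Or.inl ⟨hb, ha, h.symm⟩
    · exact Or.inr ⟨fun h => h1 h.symm, h2.symm⟩⟩
  loopless := ⟨by
    rintro a (⟨ha, hb, h⟩ | ⟨h1, h2⟩)
    · exact h.ne rfl
    · exact h2.ne rfl⟩

theorem glue_adj_mem {G : SimpleGraph V} {S : Set V} {H : SimpleGraph S} (a b : S) :
    (glue G S H).Adj a b ↔ H.Adj a b := by
  simp [glue]

theorem glue_adj_notMem {G : SimpleGraph V} {S : Set V} {H : SimpleGraph S} {a b : V}
    (h : ¬ (a ∈ S ∧ b ∈ S)) : (glue G S H).Adj a b ↔ G.Adj a b := by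
  simp only [glue]
  grind

theorem glue_induce (G : SimpleGraph V) (S : Set V) : glue G S (G.induce S) = G := by
  ext a b
  simp only [glue, SimpleGraph.comap_adj, Function.Embedding.subtype_apply]
  grind

/-- A vertex outside the module sees both or neither of `x` and `y`, so only edges within `S` move.
-/
theorem kelmans_glue {G : SimpleGraph V} {S : Set V} (hS : ∀ w ∉ S, ∀ a ∈ S, ∀ b ∈ S,
    G.Adj a w → G.Adj b w) (H : SimpleGraph S) {x y : S} (hxy : x ≠ y) :
    kelmans (glue G S H) x y = glue G S (kelmans H x y) := by
  have hxy' : (x : V) ≠ y := fun h => hxy (Subtype.ext h)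
  have key : ∀ w ∉ S, ((glue G S H).Adj x w ↔ (glue G S H).Adj y w) := by
    intro w hw
    rw [glue_adj_notMem (by tauto), glue_adj_notMem (by tauto)]
    exact ⟨hS w hw x x.2 y y.2, hS w hw y y.2 x x.2⟩
  ext a b
  by_cases hab : a ∈ S ∧ b ∈ S
  · obtain ⟨ha, hb⟩ := hab
    lift a to S using ha
    lift b to S using hb
    rw [glue_adj_mem, kelmans_adj, kelmans_adj]
    simp only [glue_adj_mem, Subtype.coe_inj, ne_eq]
  · rw [glue_adj_notMem hab, kelmans_adj, ← glue_adj_notMem (G := G) (H := H) hab]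
    have hx := x.2
    have hy := y.2
    have hne : (glue G S H).Adj a b → a ≠ b := fun h => h.ne
    grind [SimpleGraph.adj_comm]

theorem glue_dominating {G : SimpleGraph V} {S : Set V} (H : SimpleGraph S) {u : V} (huS : u ∉ S)
    (hu : ∀ v, v ≠ u → G.Adj u v) : ∀ v, v ≠ u → (glue G S H).Adj u v := fun v hv =>
  (glue_adj_notMem (by tauto)).2 (hu v hv)

/-- Kelmans operations inside a module lift to the whole graph. -/
theorem Reach.glue {G : SimpleGraph V} {S : Set V} (hS : ∀ w ∉ S, ∀ a ∈ S, ∀ b ∈ S,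
    G.Adj a w → G.Adj b w) {u : V} (huS : u ∉ S) (hu : ∀ v, v ≠ u → G.Adj u v)
    {H : SimpleGraph S} (hH : Reach (G.induce S) H) :
    Reach G (KelmansExtremal.glue G S H) := by
  induction hH with
  | refl => rw [glue_induce]; exact Relation.ReflTransGen.refl
  | tail _ h ih =>
    obtain ⟨_, x, y, hxy, rfl⟩ := h
    exact ih.tail ⟨connected_of_dominating (glue_dominating _ huS hu), x, y,
      fun h => hxy (Subtype.ext h), (kelmans_glue hS _ hxy).symm⟩

/-! ### Nested neighbourhoods: ancestors, depth and roots -/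

section Nested

/-- The closed neighbourhoods of adjacent vertices are nested, in the order prescribed by `ρ`. -/
def IsNested (ρ : V → ℕ) (G : SimpleGraph V) : Prop :=
  ∀ a b, G.Adj a b → ρ a < ρ b → ∀ w, w ≠ a → G.Adj b w → G.Adj a w

open Classical in
/-- The neighbours of `v` in `F` that precede `v`. -/
noncomputable def up (G : SimpleGraph V) (ρ : V → ℕ) (F : Finset V) (v : V) : Finset V :=
  F.filter fun a => G.Adj a v ∧ ρ a < ρ v

variable {G : SimpleGraph V} {ρ : V → ℕ} {F : Finset V}

theorem mem_up {a v : V} : a ∈ up G ρ F v ↔ a ∈ F ∧ G.Adj a v ∧ ρ a < ρ v := by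
  simp [up]

theorem IsNested.adj_of_mem_up (h : IsNested ρ G) {a b v : V} (ha : a ∈ up G ρ F v)
    (hb : b ∈ up G ρ F v) (hab : a ≠ b) : G.Adj a b := by
  rw [mem_up] at ha hb
  exact h a v ha.2.1 ha.2.2 b hab.symm hb.2.1.symm

theorem IsNested.up_subset (h : IsNested ρ G) {a b : V} (hab : G.Adj a b) (hρ : ρ a < ρ b) :
    up G ρ F a ⊆ up G ρ F b := by
  intro c hc
  rw [mem_up] at hc ⊢
  refine ⟨hc.1, h c a hc.2.1 hc.2.2 b ?_ hab, hc.2.2.trans hρ⟩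
  rintro rfl
  exact absurd hc.2.2 (by omega)

/-- The later endpoint inherits all ancestors of the earlier one and gains that one as well. Hence
depth is a proper colouring of `F`, the one used for stripping. -/
theorem IsNested.card_up_lt (h : IsNested ρ G) {a b : V} (haF : a ∈ F) (hab : G.Adj a b)
    (hρ : ρ a < ρ b) : (up G ρ F a).card < (up G ρ F b).card := by
  apply Finset.card_lt_card
  refine ⟨h.up_subset hab hρ, fun hs => ?_⟩
  have := hs (mem_up.2 ⟨haF, hab, hρ⟩)
  exact absurd (mem_up.1 this).2.2 (lt_irrefl _)

theorem IsNested.card_up_ne (h : IsNested ρ G) (hρ : Function.Injective ρ) {a b : V}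
    (ha : a ∈ F) (hb : b ∈ F) (hab : G.Adj a b) : (up G ρ F a).card ≠ (up G ρ F b).card := by
  rcases lt_or_gt_of_ne (hρ.ne hab.ne) with hlt | hlt
  · exact (h.card_up_lt ha hab hlt).ne
  · exact (h.card_up_lt hb hab.symm hlt).ne'

theorem IsNested.lt_of_card_up_lt (h : IsNested ρ G) (hρ : Function.Injective ρ) {a w : V}
    (hw : w ∈ F) (haw : G.Adj w a) (hlt : (up G ρ F a).card < (up G ρ F w).card) : ρ a < ρ w := by
  by_contra hc
  have : ρ w < ρ a := lt_of_le_of_ne (by omega) (hρ.ne haw.ne)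
  have := h.card_up_lt hw haw this
  omega

/-- Both vertices precede `w`, and two distinct ancestors of `w` are adjacent, hence of different
depth. This supplies the uniqueness required in `exists_reach_strip`. -/
theorem IsNested.eq_of_card_up_eq (h : IsNested ρ G) (hρ : Function.Injective ρ) {w a b : V}
    (hw : w ∈ F) (ha : a ∈ F) (hb : b ∈ F) (hwa : G.Adj w a) (hwb : G.Adj w b)
    (hab : (up G ρ F a).card = (up G ρ F b).card) (hlt : (up G ρ F a).card < (up G ρ F w).card) :
    a = b := by
  by_contra hne
  have h1 := h.lt_of_card_up_lt hρ hw hwa hlt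
  have h2 := h.lt_of_card_up_lt hρ hw hwb (hab ▸ hlt)
  have := h.adj_of_mem_up (mem_up.2 ⟨ha, hwa.symm, h1⟩) (mem_up.2 ⟨hb, hwb.symm, h2⟩) hne
  exact h.card_up_ne hρ ha hb this hab

theorem IsNested.clique_insert_up [DecidableEq V] (h : IsNested ρ G) (v : V) :
    ∀ a ∈ insert v (up G ρ F v), ∀ b ∈ insert v (up G ρ F v), a ≠ b → G.Adj a b := by
  intro a ha b hb hab
  rw [Finset.mem_insert] at ha hb
  rcases ha with rfl | ha <;> rcases hb with rfl | hb
  · exact absurd rfl hab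
  · exact (mem_up.1 hb).2.1.symm
  · exact (mem_up.1 ha).2.1
  · exact h.adj_of_mem_up ha hb hab

theorem card_insert_up [DecidableEq V] (v : V) :
    (insert v (up G ρ F v)).card = (up G ρ F v).card + 1 :=
  Finset.card_insert_of_notMem fun hv => absurd (mem_up.1 hv).2.2 (lt_irrefl _)

/-- The vertex of least rank works: an edge leaving its closed neighbourhood would violate nesting.
-/
theorem IsNested.exists_dominating [Finite V] (h : IsNested ρ G) (hρ : Function.Injective ρ)
    (hG : G.Connected) : ∃ u, ∀ v, v ≠ u → G.Adj u v := by
  have := hG.nonempty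
  obtain ⟨u, hu⟩ := Finite.exists_min ρ
  refine ⟨u, fun v hv => ?_⟩
  by_contra hc
  obtain ⟨p⟩ := hG.preconnected u v
  obtain ⟨d, -, hd1, hd2⟩ := p.exists_boundary_dart {w | w = u ∨ G.Adj u w} (by simp)
    (by simp [hv, hc])
  have hadj := d.adj
  simp only [Set.mem_ofPred_eq, not_or] at hd1 hd2
  rcases hd1 with h1 | h1
  · exact hd2.2 (h1 ▸ hadj)
  · exact hd2.2 (h u _ h1 (lt_of_le_of_ne (hu _) (hρ.ne h1.ne)) _ hd2.1 hadj)

end Nested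

/-! ### Nested graphs lie below, or reach subgraphs of, target graphs -/

theorem hasPath_induce_iff {G : SimpleGraph V} {S : Set V} {k : ℕ} : HasPath (G.induce S) k ↔
    ∃ l : List V, l.IsChain G.Adj ∧ l.Nodup ∧ (∀ a ∈ l, a ∈ S) ∧ l.length = k := by
  constructor
  · rintro ⟨l, hl, hn, hk⟩
    refine ⟨l.map Subtype.val, ?_, hn.map Subtype.val_injective, by simp +contextual, by simpa using hk⟩
    rw [List.isChain_map]
    exact hl
  · rintro ⟨l, hl, hn, hS, hk⟩
    lift l to List S using hS
    rw [List.isChain_map] at hl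
    exact ⟨l, hl, hn.of_map _, by simpa using hk⟩

theorem exists_max_path [Finite V] (G : SimpleGraph V) :
    ∃ m, HasPath G m ∧ ¬ HasPath G (m + 1) := by
  by_contra! h
  have : ∀ m, HasPath G m := by
    intro m
    induction m with
    | zero => exact ⟨[], by simp, by simp, rfl⟩
    | succ m ih => exact h m ih
  have := (this (Nat.card V + 1)).le_card
  omega

/-- Used to enlarge the centre `D` to at least `e` vertices, taking the additional ones from `B`
first, so that the clique shrinks as the centre grows. -/
theorem exists_superset_card_max [DecidableEq V] {S D B : Finset V} (hD : D ⊆ S) (hB : B ⊆ S)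
    {e : ℕ} (he : e ≤ S.card) : ∃ Y, D ⊆ Y ∧ Y ⊆ S ∧ Y.card = max e D.card ∧
      (Y.card = D.card ∧ (B \ Y).card ≤ B.card ∨
        Y.card = e ∧ (B \ Y).card ≤ D.card + B.card - e) := by
  by_cases h1 : e ≤ D.card
  · exact ⟨D, subset_rfl, hD, (max_eq_right h1).symm,
      Or.inl ⟨rfl, Finset.card_le_card Finset.sdiff_subset⟩⟩
  by_cases h2 : e ≤ (D ∪ B).card
  · obtain ⟨Y, hDY, hY, hYe⟩ := Finset.exists_subsuperset_card_eq
      (Finset.subset_union_left (s₁ := D) (s₂ := B)) (by omega : D.card ≤ e) h2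
    refine ⟨Y, hDY, hY.trans (Finset.union_subset hD hB), by omega, Or.inr ⟨hYe, ?_⟩⟩
    have h3 := Finset.card_le_card
      (Finset.sdiff_subset_sdiff (Finset.subset_union_right (s₁ := D) (s₂ := B)) (subset_refl Y))
    rw [Finset.card_sdiff_of_subset hY] at h3
    have h4 := Finset.card_union_le D B
    omega
  · obtain ⟨Y, hDY, hY, hYe⟩ := Finset.exists_subsuperset_card_eq
      (Finset.union_subset hD hB) (by omega : (D ∪ B).card ≤ e) he
    refine ⟨Y, Finset.subset_union_left.trans hDY, hY, by omega, Or.inr ⟨hYe, ?_⟩⟩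
    rw [Finset.sdiff_eq_empty_iff_subset.2 (Finset.subset_union_right.trans hDY)]
    simp

/-- A connected nested graph without a path on `k ≤ |V|` vertices is a spanning subgraph of some
`wGraph D B` of the right size, or it can be turned into a proper one. -/
theorem IsNested.exists_wGraph (n : ℕ) : ∀ (V : Type u) [Finite V] (G : SimpleGraph V) (ρ : V → ℕ),
    Function.Injective ρ → IsNested ρ G → G.Connected → Nat.card V = n → ∀ k, k ≤ n →
    ¬ HasPath G k → ∃ D B : Finset V, 1 ≤ D.card ∧ 2 * D.card + 2 ≤ k ∧
      2 * D.card + B.card + 1 ≤ k ∧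
      (G ≤ wGraph D B ∨ ∃ H, Reach G H ∧ H < wGraph D B) := by
  classical
  induction n using Nat.strong_induction_on with
  | _ n ih =>
  intro V _ G ρ hρ hG hconn hn k hkn hpath
  have := Fintype.ofFinite V
  obtain ⟨u, hu⟩ := hG.exists_dominating hρ hconn
  set D₀ : Finset V := Finset.univ.filter fun u => ∀ v, v ≠ u → G.Adj u v with hD₀
  have memD₀ : ∀ {a}, a ∈ D₀ ↔ ∀ v, v ≠ a → G.Adj a v := by simp [hD₀]
  set F : Finset V := Finset.univ \ D₀ with hF
  have memF : ∀ {a}, a ∈ F ↔ a ∉ D₀ := by simp [hF]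
  have huD : u ∈ D₀ := memD₀.2 hu
  have hFne : F.Nonempty := by
    by_contra hFe
    rw [Finset.not_nonempty_iff_eq_empty] at hFe
    refine hpath (HasPath.of_le_length (l := (Finset.univ : Finset V).toList)
      (isChain_toList_of_clique ?_) (Finset.nodup_toList _) ?_)
    · intro a _ b _ hab
      have ha : a ∈ D₀ := by
        by_contra h
        have := memF.2 h
        simp [hFe] at this
      exact memD₀.1 ha b hab.symm
    · rw [Finset.length_toList, Finset.card_univ, ← Nat.card_eq_fintype_card]
      omega
  -- `z` is a deepest vertex outside `D₀`, and `r` is the root of its tree.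
  obtain ⟨z, hzF, hz⟩ := Finset.exists_max_image F (fun v => (up G ρ F v).card) hFne
  obtain ⟨r, hrz, hrmin⟩ := Finset.exists_min_image (insert z (up G ρ F z)) ρ
    (Finset.insert_nonempty _ _)
  have hrF : r ∈ F := by
    rcases Finset.mem_insert.1 hrz with h | h
    · exact h ▸ hzF
    · exact (mem_up.1 h).1
  have hrup : ∀ c ∈ F, G.Adj r c → ρ r < ρ c := by
    intro c hc hrc
    refine lt_of_le_of_ne ?_ (hρ.ne hrc.ne)
    by_contra hlt
    push Not at hlt
    have hcr : c ∈ up G ρ F r := mem_up.2 ⟨hc, hrc.symm, hlt⟩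
    have hcz : c ∈ up G ρ F z := by
      rcases Finset.mem_insert.1 hrz with h | h
      · exact h ▸ hcr
      · exact hG.up_subset (mem_up.1 h).2.1 (mem_up.1 h).2.2 hcr
    have := hrmin c (Finset.mem_insert_of_mem hcz)
    omega
  set S : Finset V := F.filter fun a => a = r ∨ G.Adj r a with hS
  set O : Finset V := F.filter fun a => ¬ (a = r ∨ G.Adj r a) with hO
  have memS : ∀ {a}, a ∈ S ↔ a ∈ F ∧ (a = r ∨ G.Adj r a) := by simp [hS]
  have memO : ∀ {a}, a ∈ O ↔ a ∈ F ∧ ¬ (a = r ∨ G.Adj r a) := by simp [hO]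
  have hSF : ∀ {a}, a ∈ S → a ∈ F := fun h => (memS.1 h).1
  have hOF : ∀ {a}, a ∈ O → a ∈ F := fun h => (memO.1 h).1
  have hSO : ∀ {a}, a ∈ F → a ∈ S ∨ a ∈ O := by
    intro a ha
    by_cases h : a = r ∨ G.Adj r a
    · exact Or.inl (memS.2 ⟨ha, h⟩)
    · exact Or.inr (memO.2 ⟨ha, h⟩)
  have hdis : ∀ {a}, a ∈ S → a ∉ O := fun h h' => (memO.1 h').2 (memS.1 h).2
  have hno : ∀ {a w}, a ∈ S → w ∈ O → ¬ G.Adj a w := by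
    intro a w ha hw haw
    obtain ⟨haF, ha⟩ := memS.1 ha
    obtain ⟨hwF, hw⟩ := memO.1 hw
    rcases ha with rfl | ha
    · exact hw (Or.inr haw)
    · exact hw (Or.inr (hG r a ha (hrup a haF ha) w (fun h => hw (Or.inl h)) haw))
  -- With no other tree, `r` would dominate and belong to `D₀`.
  have hOne : O.Nonempty := by
    by_contra h
    rw [Finset.not_nonempty_iff_eq_empty] at h
    refine memF.1 hrF (memD₀.2 fun v hv => ?_)
    by_cases hvD : v ∈ D₀
    · exact (memD₀.1 hvD r hv.symm).symm
    · rcases hSO (memF.2 hvD) with h' | h'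
      · exact (memS.1 h').2.resolve_left hv
      · simp [h] at h'
  have hrS : r ∈ S := memS.2 ⟨hrF, Or.inl rfl⟩
  have hzS : ∀ c ∈ insert z (up G ρ F z), c ∈ S := by
    intro c hc
    have hcF : c ∈ F := by
      rcases Finset.mem_insert.1 hc with h | h
      · exact h ▸ hzF
      · exact (mem_up.1 h).1
    by_cases hcr : c = r
    · exact hcr ▸ hrS
    · exact memS.2 ⟨hcF, Or.inr (hG.clique_insert_up z r hrz c hc (Ne.symm hcr))⟩
  obtain ⟨z', hz'O, hz'⟩ := Finset.exists_max_image O (fun v => (up G ρ F v).card) hOne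
  have hz'O' : ∀ c ∈ insert z' (up G ρ F z'), c ∈ O := by
    intro c hc
    rcases Finset.mem_insert.1 hc with h | h
    · exact h ▸ hz'O
    · obtain ⟨h1, h2, -⟩ := mem_up.1 h
      exact (hSO h1).resolve_left fun h' => hno h' hz'O h2
  set e := (up G ρ F z').card with he
  have hez : e ≤ (up G ρ F z).card := hz z' (hOF hz'O)
  have hScard : e + 1 ≤ S.card := by
    have := Finset.card_le_card (show insert z (up G ρ F z) ⊆ S from hzS)
    rw [card_insert_up] at this
    omega
  have huS : u ∉ S := fun h => memF.1 (hSF h) huD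
  have huO : u ∉ O := fun h => memF.1 (hOF h) huD
  have hScard' : Nat.card (S : Set V) = S.card := by simp
  have hSn : S.card < n := by
    have := Finset.card_lt_univ_of_notMem huS
    rwa [← Nat.card_eq_fintype_card, hn] at this
  obtain ⟨m, hm, hm'⟩ := exists_max_path (G.induce (S : Set V))
  have hem : e + 1 ≤ m := by
    by_contra hlt
    refine hm' (hasPath_induce_iff.2
      ⟨(insert z (up G ρ F z)).toList.take (m + 1), (isChain_toList_of_clique
        (hG.clique_insert_up z)).take _, (Finset.nodup_toList _).sublist (List.take_sublist _ _),
        ?_, ?_⟩)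
    · intro a ha
      have := List.mem_of_mem_take ha
      exact hzS a (by simpa using this)
    · rw [List.length_take, Finset.length_toList, card_insert_up]
      omega
  -- Otherwise join a longest path of `S` through `u` to the clique of `e + 1` vertices formed by
  -- `z'` and its ancestors. The other `D₀.card - 1` dominating vertices add two each, giving `m + e
  -- + 2 * D₀.card` in total, as far as vertices are available.
  have hbound : m + e + 1 + 2 * D₀.card ≤ k := by
    by_contra hlt
    obtain ⟨l, hl, hln, hlS, hlm⟩ := hasPath_induce_iff.1 hm
    have hDpos : 1 ≤ D₀.card := Finset.card_pos.2 ⟨u, huD⟩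
    refine hpath (exists_path_extend (D₀.erase u)
      (fun v hv => memD₀.1 (Finset.mem_of_mem_erase hv))
      (l ++ u :: (insert z' (up G ρ F z')).toList) ?_ ?_ (by simp) ?_ k (by omega) ?_)
    · rw [List.isChain_append, List.isChain_cons]
      refine ⟨hl, ⟨?_, isChain_toList_of_clique (hG.clique_insert_up z')⟩, ?_⟩
      · intro b hb
        have hb' : b ∈ insert z' (up G ρ F z') := by simpa using List.mem_of_head? hb
        exact hu b fun h => huO (h ▸ hz'O' b hb')
      · intro a ha b hb
        have hb' : u = b := by simpa using hb
        subst hb'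
        exact (hu a fun h => huS (h ▸ hlS a (List.mem_of_getLast? ha))).symm
    · rw [List.nodup_append, List.nodup_cons]
      refine ⟨hln, ⟨fun h => huO (hz'O' u (by simpa using h)), Finset.nodup_toList _⟩, ?_⟩
      rintro a ha b hb rfl
      rcases List.mem_cons.1 hb with h | h
      · exact huS (h ▸ hlS a ha)
      · exact hdis (hlS a ha) (hz'O' a (by simpa using h))
    · intro v hv h
      obtain ⟨hvu, hvD⟩ := Finset.mem_erase.1 hv
      rcases List.mem_append.1 h with h | h
      · exact memF.1 (hSF (hlS v h)) hvD
      · rcases List.mem_cons.1 h with h | h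
        · exact hvu h
        · exact memF.1 (hOF (hz'O' v (by simpa using h))) hvD
    · rw [List.length_append, List.length_cons, Finset.length_toList, card_insert_up,
        Finset.card_erase_of_mem huD]
      omega
  -- Induction applies to `S` with `m + 1` in place of `k`, unless a path covers all of `S`; then
  -- the empty centre and the clique on `S` serve.
  obtain ⟨D₁, B₁, hD₁, hDB₁, hD₁e, H₁, hH₁, hH₁W⟩ : ∃ D₁ B₁ : Finset (S : Set V),
      2 * D₁.card + 1 ≤ m ∧ 2 * D₁.card + B₁.card ≤ m ∧ (D₁ = ∅ → B₁ = Finset.univ) ∧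
      ∃ H₁, Reach (G.induce (S : Set V)) H₁ ∧ H₁ ≤ wGraph D₁ B₁ := by
    by_cases hmS : m + 1 ≤ S.card
    · have hSc : (G.induce (S : Set V)).Connected := by
        refine connected_of_dominating (u := ⟨r, hrS⟩) fun v hv => ?_
        have := memS.1 v.2
        exact this.2.resolve_left fun h => hv (Subtype.ext h)
      obtain ⟨D₁, B₁, h1, h2, h3, h4⟩ := ih S.card hSn (S : Set V) (G.induce (S : Set V))
        (fun v => ρ v) (hρ.comp Subtype.val_injective)
        (fun a b hab hlt w hw hbw => hG a b hab hlt w (fun h => hw (Subtype.ext h)) hbw)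
        hSc hScard' (m + 1) hmS hm'
      refine ⟨D₁, B₁, by omega, by omega, fun h => by simp [h] at h1, ?_⟩
      rcases h4 with h4 | ⟨H, h4, h5⟩
      · exact ⟨_, Relation.ReflTransGen.refl, h4⟩
      · exact ⟨H, h4, h5.le⟩
    · refine ⟨∅, Finset.univ, by simp; omega, ?_, fun _ => rfl, _, Relation.ReflTransGen.refl, ?_⟩
      · rw [Finset.card_univ, ← Nat.card_eq_fintype_card, hScard']
        simp; omega
      · intro a b hab
        exact ⟨hab.ne, by simp⟩
  set D' : Finset V := D₁.map (Function.Embedding.subtype _) with hD'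
  set B' : Finset V := B₁.map (Function.Embedding.subtype _) with hB'
  have hD'S : D' ⊆ S := by
    intro a ha
    obtain ⟨b, -, rfl⟩ := Finset.mem_map.1 ha
    exact b.2
  have hB'S : B' ⊆ S := by
    intro a ha
    obtain ⟨b, -, rfl⟩ := Finset.mem_map.1 ha
    exact b.2
  have hD'c : D'.card = D₁.card := Finset.card_map _
  have hB'c : B'.card = B₁.card := Finset.card_map _
  obtain ⟨Y, hDY, hYS, hYc, hYB⟩ := exists_superset_card_max hD'S hB'S (by omega : e ≤ S.card)
  have hDc : (D₀ ∪ Y).card = D₀.card + Y.card := Finset.card_union_of_disjoint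
    (Finset.disjoint_right.2 fun a ha => memF.1 (hSF (hYS ha)))
  have hDpos : 1 ≤ D₀.card := Finset.card_pos.2 ⟨u, huD⟩
  have hmodule : ∀ w ∉ (S : Set V), ∀ a ∈ (S : Set V), ∀ b ∈ (S : Set V),
      G.Adj a w → G.Adj b w := by
    intro w hw a ha b hb haw
    by_cases hwD : w ∈ D₀
    · exact (memD₀.1 hwD b fun h => hw (h ▸ hb)).symm
    · exact absurd haw (hno ha ((hSO (memF.2 hwD)).resolve_left hw))
  have hreach := hH₁.glue hmodule huS hu
  set G₁ := glue G (S : Set V) H₁ with hG₁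
  have hG₁adj : ∀ {a b}, a ∉ S → (G₁.Adj a b ↔ G.Adj a b) := fun h =>
    glue_adj_notMem fun h' => h h'.1
  have hlev : ∀ a ∈ O, (up G ρ F a).card ≤ e := hz'
  have hW : ∀ a b, G₁.Adj a b → (wGraph (D₀ ∪ Y) (B' \ Y)).Adj a b ∨
      (a ∈ (O : Set V) ∧ b ∈ (O : Set V)) := by
    intro a b hab
    by_cases haD : a ∈ D₀
    · exact Or.inl ⟨hab.ne, Or.inl (Finset.mem_union_left _ haD)⟩
    by_cases hbD : b ∈ D₀
    · exact Or.inl ⟨hab.ne, Or.inr (Or.inl (Finset.mem_union_left _ hbD))⟩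
    rcases hSO (memF.2 haD) with ha | ha <;> rcases hSO (memF.2 hbD) with hb | hb
    · have h : H₁.Adj ⟨a, ha⟩ ⟨b, hb⟩ := (glue_adj_mem (⟨a, ha⟩ : (S : Set V)) ⟨b, hb⟩).1 hab
      have hD : ∀ c : (S : Set V), c ∈ D₁ → (c : V) ∈ D' := fun c hc =>
        Finset.mem_map_of_mem _ hc
      have hB : ∀ c : (S : Set V), c ∈ B₁ → (c : V) ∈ B' := fun c hc =>
        Finset.mem_map_of_mem _ hc
      refine Or.inl ⟨hab.ne, ?_⟩
      rcases (hH₁W h).2 with h | h | ⟨h1, h2⟩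
      · exact Or.inl (Finset.mem_union_right _ (hDY (hD _ h)))
      · exact Or.inr (Or.inl (Finset.mem_union_right _ (hDY (hD _ h))))
      · have h1' := hB _ h1
        have h2' := hB _ h2
        simp only [Finset.mem_union, Finset.mem_sdiff]
        tauto
    · exact absurd ((hG₁adj (fun h => hdis h hb)).1 hab.symm) (fun h => hno ha hb h.symm)
    · exact absurd ((hG₁adj (fun h => hdis h ha)).1 hab) (fun h => hno hb ha h.symm)
    · exact Or.inr ⟨ha, hb⟩
  -- After `hbound` the two size bounds amount to `2 * Y.card + 1 ≤ m + e` and `2 * Y.card + (B' \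
  -- Y).card ≤ m + e`, checked for `Y.card = D'.card` and for `Y.card = e`.
  refine ⟨D₀ ∪ Y, B' \ Y, by omega, by omega, by omega, ?_⟩
  -- If `Y` is empty, then `e = 0`, so `O` is independent, and `B₁` is all of `S`; no operation is
  -- needed.
  by_cases hYe : Y = ∅
  · left
    have hY0 : Y.card = 0 := by simp [hYe]
    have hD₁0 : D₁ = ∅ := Finset.card_eq_zero.1 (by omega)
    have hB₁ := hD₁e hD₁0
    intro a b hab
    refine ⟨hab.ne, ?_⟩
    by_cases haD : a ∈ D₀
    · exact Or.inl (Finset.mem_union_left _ haD)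
    by_cases hbD : b ∈ D₀
    · exact Or.inr (Or.inl (Finset.mem_union_left _ hbD))
    have hB : ∀ c ∈ S, c ∈ B' \ Y := by
      intro c hc
      simp [hYe, hB', hB₁, hc]
    rcases hSO (memF.2 haD) with ha | ha <;> rcases hSO (memF.2 hbD) with hb | hb
    · exact Or.inr (Or.inr ⟨hB a ha, hB b hb⟩)
    · exact absurd hab (hno ha hb)
    · exact absurd hab.symm (hno hb ha)
    · have h1 := hlev a ha
      have h2 := hlev b hb
      exact absurd (by omega) (hG.card_up_ne hρ (hOF ha) (hOF hb) hab)
  · right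
    have hYpos : 0 < Y.card := Finset.card_pos.2 (Finset.nonempty_iff_ne_empty.2 hYe)
    -- An enumeration of `Y`; the value `r` beyond its size plays no role.
    set y : ℕ → V := fun j => if h : j < Y.card then Y.equivFin.symm ⟨j, h⟩ else r with hy
    have hyY : ∀ j < Y.card, y j ∈ Y := fun j hj => by simp [hy, hj]
    have hyi : ∀ i < Y.card, ∀ j < Y.card, y i = y j → i = j := by
      intro i hi j hj hij
      simp only [hy, hi, hj, dif_pos] at hij
      simpa using Y.equivFin.symm.injective (Subtype.ext hij)
    obtain ⟨H, hH, hHW, hHl⟩ := exists_reach_strip (D := D₀ ∪ Y) (B := B' \ Y) (O := (O : Set V))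
      (u := u) huO (ℓ := fun a => (up G ρ F a).card) (r := Y.card) (y := y)
      (fun j hj => Finset.mem_union_right _ (hyY j hj))
      (fun j hj => hdis (hYS (hyY j hj)))
      (fun j hj h => huS (h ▸ hYS (hyY j hj))) hyi
      (fun a ha => (hlev a ha).trans (by omega)) _ G₁ rfl (glue_dominating _ huS hu) hW
      (fun a ha b hb hab => hG.card_up_ne hρ (hOF ha) (hOF hb)
        ((hG₁adj fun h => hdis h ha).1 hab))
      (fun w hw a ha b hb hwa hwb => hG.eq_of_card_up_eq hρ (hOF hw) (hOF ha) (hOF hb)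
        ((hG₁adj fun h => hdis h hw).1 hwa) ((hG₁adj fun h => hdis h hw).1 hwb))
      (fun w hw j hj h => absurd ((hG₁adj fun h => hdis h hw).1 h).symm
        (hno (hYS (hyY j hj)) hw))
    refine ⟨H, hreach.trans hH, hHW, fun hle => ?_⟩
    -- Strictness: a root `w` in `O` has depth 0, so it never becomes adjacent to `y 0`, although
    -- `wGraph` has that edge.
    obtain ⟨w, hwO, hw⟩ := Finset.exists_min_image O ρ hOne
    have hw0 : (up G ρ F w).card = 0 := by
      rw [Finset.card_eq_zero, Finset.eq_empty_iff_forall_notMem]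
      intro c hc
      obtain ⟨h1, h2, h3⟩ := mem_up.1 hc
      have := hw c ((hSO h1).resolve_left fun h' => hno h' hwO h2)
      omega
    have hadj : (wGraph (D₀ ∪ Y) (B' \ Y)).Adj w (y 0) :=
      ⟨fun h => hdis (hYS (hyY 0 hYpos)) (h ▸ hwO),
        Or.inr (Or.inl (Finset.mem_union_right _ (hyY 0 hYpos)))⟩
    exact hHl w hwO 0 hYpos ((show wGraph (D₀ ∪ Y) (B' \ Y) ≤ H from hle) hadj) hw0

/-! ### Longest paths and isomorphism type of the target graphs -/

-- A vertex outside `D ∪ B` has all its neighbours in `D`, so on a path such vertices are separated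
-- by vertices of `D`; a visit to `B` costs one more separator. The clauses about the head make the
-- induction on the list work.
open Classical in
theorem wGraph_isChain_count {D B : Finset V} (hDB : Disjoint D B) :
    ∀ l : List V, l.IsChain (wGraph D B).Adj →
      l.countP (fun v => v ∉ D ∧ v ∉ B) ≤ l.countP (· ∈ D) + 1 ∧
      ((∀ a ∈ l.head?, a ∈ D ∨ a ∈ B) →
        l.countP (fun v => v ∉ D ∧ v ∉ B) ≤ l.countP (· ∈ D)) ∧
      ((∃ b ∈ l, b ∈ B) → l.countP (fun v => v ∉ D ∧ v ∉ B) ≤ l.countP (· ∈ D)) ∧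
      ((∃ b ∈ l, b ∈ B) → (∀ a ∈ l.head?, a ∈ D) →
        l.countP (fun v => v ∉ D ∧ v ∉ B) + 1 ≤ l.countP (· ∈ D)) := by
  intro l
  induction l with
  | nil => simp
  | cons a l ih =>
    intro hl
    rw [List.isChain_cons] at hl
    obtain ⟨h1, h2, h3, h4⟩ := ih hl.2
    have hhead := hl.1
    by_cases haD : a ∈ D
    · have haB : a ∉ B := Finset.disjoint_left.1 hDB haD
      have hex : (∃ b ∈ a :: l, b ∈ B) → ∃ b ∈ l, b ∈ B := by
        rintro ⟨b, hb, hbB⟩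
        rcases List.mem_cons.1 hb with rfl | hb
        · exact absurd hbB haB
        · exact ⟨b, hb, hbB⟩
      rw [List.countP_cons_of_neg (by simp [haD]), List.countP_cons_of_pos (by simp [haD])]
      exact ⟨by omega, fun _ => by omega, fun _ => by omega, fun h _ => by have := h3 (hex h); omega⟩
    · by_cases haB : a ∈ B
      · have hhd : ∀ c ∈ l.head?, c ∈ D ∨ c ∈ B := by
          intro c hc
          have := (hhead c hc).2
          tauto
        have h2' := h2 hhd
        rw [List.countP_cons_of_neg (by simp [haB]), List.countP_cons_of_neg (by simp [haD])]
        exact ⟨by omega, fun _ => h2', fun _ => h2', fun _ h => absurd (h a (by simp)) haD⟩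
      · have hhd : ∀ c ∈ l.head?, c ∈ D := by
          intro c hc
          have := (hhead c hc).2
          tauto
        have hex : (∃ b ∈ a :: l, b ∈ B) → ∃ b ∈ l, b ∈ B := by
          rintro ⟨b, hb, hbB⟩
          rcases List.mem_cons.1 hb with rfl | hb
          · exact absurd hbB haB
          · exact ⟨b, hb, hbB⟩
        have h2' := h2 fun c hc => Or.inl (hhd c hc)
        rw [List.countP_cons_of_pos (by simp [haB, haD]), List.countP_cons_of_neg (by simp [haD])]
        refine ⟨by omega, fun h => ?_, fun h => h4 (hex h) hhd,
          fun _ h => absurd (h a (by simp)) haD⟩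
        have := h a (by simp)
        tauto

theorem not_hasPath_wGraph {D B : Finset V} (hDB : Disjoint D B) (hB : 1 ≤ B.card) {k : ℕ}
    (hk : 2 * D.card + B.card + 1 ≤ k) : ¬ HasPath (wGraph D B) k := by
  classical
  rintro ⟨l, hl, hn, rfl⟩
  obtain ⟨h1, -, h3, -⟩ := wGraph_isChain_count hDB l hl
  have hcard : ∀ E : Finset V, l.countP (· ∈ E) ≤ E.card := by
    intro E
    rw [List.countP_eq_length_filter, ← List.toFinset_card_of_nodup (hn.filter _)]
    apply Finset.card_le_card
    intro v hv
    simpa using (List.mem_filter.1 (List.mem_toFinset.1 hv)).2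
  have hlen : l.length = l.countP (· ∈ D) + l.countP (· ∈ B) +
      l.countP (fun v => v ∉ D ∧ v ∉ B) := by
    clear hl hn h1 h3 hcard hk
    induction l with
    | nil => rfl
    | cons a l ih =>
      have : a ∈ D → a ∉ B := fun h => Finset.disjoint_left.1 hDB h
      by_cases haD : a ∈ D
      · simp [haD, this haD, ih]; omega
      · by_cases haB : a ∈ B <;> simp [haD, haB, ih] <;> omega
  have hD := hcard D
  have hB' := hcard B
  by_cases hb : ∃ b ∈ l, b ∈ B
  · have := h3 hb
    omega
  · have : l.countP (· ∈ B) = 0 := by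
      rw [List.countP_eq_zero]
      intro a ha
      simpa using fun h => hb ⟨a, ha, h⟩
    omega

theorem wGraph_mono {D B B' : Finset V} (h : ∀ b ∈ B, b ∈ B' ∨ b ∈ D) : wGraph D B ≤ wGraph D B' := by
  intro a b hab
  refine ⟨hab.1, ?_⟩
  rcases hab.2 with h' | h' | ⟨h1, h2⟩
  · exact Or.inl h'
  · exact Or.inr (Or.inl h')
  · have h1' := h a h1
    have h2' := h b h2
    tauto

theorem eq_wGraph_of_iso {W : Type*} {G : SimpleGraph V} {D B : Finset W}
    (φ : G ≃g wGraph D B) : ∃ D' B' : Finset V, D'.card = D.card ∧ B'.card = B.card ∧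
      (Disjoint D B → Disjoint D' B') ∧ G = wGraph D' B' := by
  refine ⟨D.map φ.symm.toEquiv.toEmbedding, B.map φ.symm.toEquiv.toEmbedding, Finset.card_map _,
    Finset.card_map _, fun h => (Finset.disjoint_map _).2 h, ?_⟩
  have hmem : ∀ (E : Finset W) (a : V), a ∈ E.map φ.symm.toEquiv.toEmbedding ↔ φ a ∈ E := by
    intro E a
    exact Finset.mem_map_equiv
  ext a b
  rw [wGraph_adj, hmem, hmem, hmem, hmem, ← φ.map_adj_iff, wGraph_adj]
  simp [φ.injective.eq_iff]

theorem wGraph_iso_graphW [Finite V] {D B : Finset V} (hDB : Disjoint D B) {n m s : ℕ}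
    (hn : Nat.card V = n) (hs : D.card = s) (hm : 2 * s + B.card = m) (hmn : m ≤ n) :
    Nonempty (wGraph D B ≃g graphW n m s) := by
  classical
  have := Fintype.ofFinite V
  set C : Finset V := Finset.univ \ (D ∪ B) with hC
  have hCc : C.card = n - m + s := by
    rw [hC, Finset.card_sdiff_of_subset (Finset.subset_univ _),
      Finset.card_union_of_disjoint hDB, Finset.card_univ, ← Nat.card_eq_fintype_card, hn]
    have : D.card + B.card ≤ n := by
      rw [← Finset.card_union_of_disjoint hDB, ← hn, Nat.card_eq_fintype_card]
      exact Finset.card_le_univ _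
    omega
  let eD : Fin s ≃ D := (Fin.castOrderIso hs.symm).toEquiv.trans D.equivFin.symm
  let eC : Fin (n - m + s) ≃ C := (Fin.castOrderIso hCc.symm).toEquiv.trans C.equivFin.symm
  let eB : Fin (m - 2 * s) ≃ B :=
    (Fin.castOrderIso (by omega : m - 2 * s = B.card)).toEquiv.trans B.equivFin.symm
  let f : Fin s ⊕ (Fin (n - m + s) ⊕ Fin (m - 2 * s)) → V :=
    Sum.elim (fun i => eD i) (Sum.elim (fun i => eC i) (fun i => eB i))
  have hDD : ∀ i, (eD i : V) ∈ D ∧ (eD i : V) ∉ B := fun i =>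
    ⟨(eD i).2, Finset.disjoint_left.1 hDB (eD i).2⟩
  have hBB : ∀ i, (eB i : V) ∉ D ∧ (eB i : V) ∈ B := fun i =>
    ⟨Finset.disjoint_right.1 hDB (eB i).2, (eB i).2⟩
  have hCC : ∀ i, (eC i : V) ∉ D ∧ (eC i : V) ∉ B := by
    intro i
    have h : (eC i : V) ∈ Finset.univ \ (D ∪ B) := (eC i).2
    rw [Finset.mem_sdiff, Finset.mem_union, not_or] at h
    exact h.2
  have hinj : Function.Injective f := by
    rintro (i | i | i) (j | j | j) hij <;> simp only [f, Sum.elim_inl, Sum.elim_inr] at hij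
    · rw [eD.injective (Subtype.ext hij)]
    · exact absurd (hDD i).1 (hij ▸ (hCC j).1)
    · exact absurd (hDD i).1 (hij ▸ (hBB j).1)
    · exact absurd (hDD j).1 (hij ▸ (hCC i).1)
    · rw [eC.injective (Subtype.ext hij)]
    · exact absurd (hBB j).2 (hij ▸ (hCC i).2)
    · exact absurd (hDD j).1 (hij ▸ (hBB i).1)
    · exact absurd (hBB i).2 (hij ▸ (hCC j).2)
    · rw [eB.injective (Subtype.ext hij)]
  have hbij : Function.Bijective f := by
    rw [Fintype.bijective_iff_injective_and_card]
    refine ⟨hinj, ?_⟩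
    rw [← Nat.card_eq_fintype_card (α := V), hn]
    simp only [Fintype.card_sum, Fintype.card_fin]
    have : D.card + B.card ≤ n := by
      rw [← Finset.card_union_of_disjoint hDB, ← hn, Nat.card_eq_fintype_card]
      exact Finset.card_le_univ _
    omega
  refine ⟨SimpleGraph.Iso.symm ⟨Equiv.ofBijective f hbij, ?_⟩⟩
  intro p q
  simp only [Equiv.ofBijective_apply]
  rw [wGraph_adj, hinj.ne_iff]
  rcases p with i | i | i <;> rcases q with j | j | j <;>
    simp [f, graphW, join, hDD, hBB, hCC, completeBipartiteGraph]

/-! ### Undoing a Kelmans operation -/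

/-- In `wGraph D B` the target `y` lies in the centre, while `x`, `a` and `b` do not. Back in `G`
the edge `xy` and the private neighbours `a`, `b` allow a path through `B` with one vertex more than
the target graph would. -/
theorem hasPath_of_kelmans_eq_wGraph [Finite V] {G : SimpleGraph V} {x y : V} (hxy : G.Adj x y)
    {a b : V} (hxa : G.Adj x a) (hay : a ≠ y) (hya : ¬ G.Adj y a) (hyb : G.Adj y b) (hbx : b ≠ x)
    (hxb : ¬ G.Adj x b) {D B : Finset V} (hDB : Disjoint D B) (hB : 1 ≤ B.card)
    (hK : kelmans G x y = wGraph D B) {k : ℕ} (hk : 2 * D.card + B.card + 1 = k)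
    (hkn : k ≤ Nat.card V) : HasPath G k := by
  classical
  have := Fintype.ofFinite V
  have hax : a ≠ x := hxa.ne'
  have hby : b ≠ y := hyb.ne'
  have hne := hxy.ne
  have hsrc : ∀ w, w ≠ x → w ≠ y → (wGraph D B).Adj x w → G.Adj x w ∧ G.Adj y w :=
    fun w h1 h2 h => (kelmans_adj_source hne h1 h2).1 (hK ▸ h)
  have hya' : (wGraph D B).Adj y a := hK ▸ (kelmans_adj_target hne hay).2 (Or.inr hxa)
  have hxD : x ∉ D := fun h => hya (hsrc a hax hay ⟨hax.symm, Or.inl h⟩).2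
  have haD : a ∉ D := fun h => hya (hsrc a hax hay ⟨hax.symm, Or.inr (Or.inl h)⟩).2
  have hbD : b ∉ D := fun h => hxb (hsrc b hbx hby ⟨hbx.symm, Or.inr (Or.inl h)⟩).1
  have hyD : y ∈ D := by
    have h1 : (wGraph D B).Adj x y := hK ▸ (kelmans_adj_self hne).2 hxy
    by_contra hyD
    have hxB : x ∈ B := by
      have := h1.2
      tauto
    have haB : a ∈ B := by
      have := hya'.2
      tauto
    exact hya (hsrc a hax hay ⟨hax.symm, Or.inr (Or.inr ⟨hxB, haB⟩)⟩).2
  have hyB : y ∉ B := Finset.disjoint_left.1 hDB hyD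
  have hor : ∀ w, w ≠ x → w ≠ y → G.Adj y w ∨ G.Adj x w := fun w h1 h2 =>
    (kelmans_adj_target hne h2).1 (hK ▸ (show (wGraph D B).Adj y w from ⟨h2.symm, Or.inl hyD⟩))
  have hBB : ∀ w ∈ B, ∀ v ∈ B, w ≠ x → v ≠ x → w ≠ v → G.Adj w v := fun w hw v hv h1 h2 h =>
    (kelmans_adj_of_ne h1 (fun e : w = y => hyB (e ▸ hw)) h2 (fun e : v = y => hyB (e ▸ hv))).1
      (hK ▸ (show (wGraph D B).Adj w v from ⟨h, Or.inr (Or.inr ⟨hw, hv⟩)⟩))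
  have hU : ∀ u ∈ D.erase y, ∀ v, v ≠ u → G.Adj u v := by
    intro u hu v hv
    obtain ⟨huy, huD⟩ := Finset.mem_erase.1 hu
    have hux : u ≠ x := fun h => hxD (h ▸ huD)
    have hs := hsrc u hux huy ⟨hux.symm, Or.inr (Or.inl huD)⟩
    by_cases hvx : v = x
    · exact hvx ▸ hs.1.symm
    by_cases hvy : v = y
    · exact hvy ▸ hs.2.symm
    · exact (kelmans_adj_of_ne hux huy hvx hvy).1
        (hK ▸ (show (wGraph D B).Adj u v from ⟨hv.symm, Or.inl huD⟩))
  have hDpos : 1 ≤ D.card := Finset.card_pos.2 ⟨y, hyD⟩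
  -- The other vertices of `D` still dominate in `G`, so `B.card + 3` vertices avoiding them
  -- suffice: `B.card + 3 + 2 * (D.card - 1) = k`.
  have hext : ∀ l : List V, l.IsChain G.Adj → l.Nodup → l.length = B.card + 3 →
      (∀ v ∈ l, v ∈ D → v = y) → HasPath G k := by
    intro l hl hn hlen hlD
    refine exists_path_extend (D.erase y) hU l hl hn ?_ ?_ k hkn ?_
    · rintro rfl
      simp at hlen
    · intro u hu hul
      obtain ⟨huy, huD⟩ := Finset.mem_erase.1 hu
      exact huy (hlD u hul huD)
    · rw [Finset.card_erase_of_mem hyD]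
      omega
  have hBD : ∀ v ∈ B, v ∉ D := fun v hv => Finset.disjoint_right.1 hDB hv
  by_cases hxB : x ∈ B
  · have hboth : ∀ w ∈ B, w ≠ x → G.Adj x w ∧ G.Adj y w := fun w hw h =>
      hsrc w h (fun h => hyB (h ▸ hw)) ⟨h.symm, Or.inr (Or.inr ⟨hxB, hw⟩)⟩
    have haB : a ∉ B := fun h => hya (hboth a h hax).2
    have hbB : b ∉ B := fun h => hxb (hboth b h hbx).1
    have hab : a ≠ b := fun h => hya (h ▸ hyb)
    have hmem : ∀ v, v ∈ (B.erase x).toList ↔ v ≠ x ∧ v ∈ B := by simp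
    have hchain : (B.erase x).toList.IsChain G.Adj := isChain_toList_of_clique fun w hw v hv h =>
      hBB w (Finset.mem_of_mem_erase hw) v (Finset.mem_of_mem_erase hv)
        (Finset.ne_of_mem_erase hw) (Finset.ne_of_mem_erase hv) h
    -- If `x ∈ B`, the rest of `B` is joined to both `x` and `y`, so it can be traversed between
    -- them, with `a` and `b` as ends.
    refine hext (a :: x :: ((B.erase x).toList ++ [y, b])) ?_ ?_ ?_ ?_
    · rw [List.isChain_cons, List.isChain_cons, List.isChain_append]
      refine ⟨by simpa using hxa.symm, ?_, hchain, by simpa using hyb, ?_⟩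
      · intro v hv
        have : v ≠ x ∧ G.Adj x v := by
          rw [List.head?_append] at hv
          cases hh : (B.erase x).toList.head? with
          | none =>
            have : y = v := by simpa [hh] using hv
            exact this ▸ ⟨hne.symm, hxy⟩
          | some w =>
            have : w = v := by simpa [hh] using hv
            have hw := (hmem w).1 (List.mem_of_head? hh)
            exact this ▸ ⟨hw.1, (hboth w hw.2 hw.1).1⟩
        exact this.2
      · intro v hv w hw
        have hw' : y = w := by simpa using hw
        have hv' := (hmem v).1 (List.mem_of_getLast? hv)
        exact hw' ▸ (hboth v hv'.2 hv'.1).2.symm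
    · simp only [List.nodup_cons, List.nodup_append, List.mem_cons, List.mem_append, hmem,
        Finset.nodup_toList, List.not_mem_nil]
      grind
    · simp only [List.length_cons, List.length_append, Finset.length_toList, List.length_nil,
        Finset.card_erase_of_mem hxB]
      omega
    · intro v hv hvD
      simp only [List.mem_cons, List.mem_append, hmem, List.not_mem_nil] at hv
      grind
  -- If `x ∉ B`, the path starts at an independent vertex `i`, crosses the edge `xy` in either
  -- direction, and then runs through all of `B`.
  · have hpath : ∀ p q i β : V, (p = x ∧ q = y ∨ p = y ∧ q = x) → i ∉ D → i ∉ B → i ≠ x →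
        β ∈ B → G.Adj i p → G.Adj q β → HasPath G k := by
      intro p q i β hpq hiD hiB hix hβ hip hqβ
      have hpq' : G.Adj p q := by
        rcases hpq with ⟨rfl, rfl⟩ | ⟨rfl, rfl⟩
        · exact hxy
        · exact hxy.symm
      have hiy : i ≠ y := fun h => hiD (h ▸ hyD)
      have hmem : ∀ v, v ∈ (B.erase β).toList ↔ v ≠ β ∧ v ∈ B := by simp
      have hBx : ∀ v ∈ B, v ≠ x := fun v hv h => hxB (h ▸ hv)
      have hchain : (B.erase β).toList.IsChain G.Adj := isChain_toList_of_clique fun w hw v hv h =>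
        hBB w (Finset.mem_of_mem_erase hw) v (Finset.mem_of_mem_erase hv)
          (hBx w (Finset.mem_of_mem_erase hw)) (hBx v (Finset.mem_of_mem_erase hv)) h
      refine hext (i :: p :: q :: β :: (B.erase β).toList) ?_ ?_ ?_ ?_
      · simp only [List.isChain_cons_cons]
        rw [List.isChain_cons]
        refine ⟨hip, hpq', hqβ, ?_, hchain⟩
        intro v hv
        have hv' := (hmem v).1 (List.mem_of_head? hv)
        exact hBB β hβ v hv'.2 (hBx β hβ) (hBx v hv'.2) hv'.1.symm
      · simp only [List.nodup_cons, List.mem_cons, hmem, Finset.nodup_toList]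
        grind
      · simp only [List.length_cons, Finset.length_toList, Finset.card_erase_of_mem hβ]
        omega
      · intro v hv hvD
        simp only [List.mem_cons, hmem] at hv
        grind
    obtain ⟨β, hβ⟩ := Finset.card_pos.1 hB
    -- A spare independent vertex exists because `D.card + B.card + 1 < k ≤ Nat.card V`. It is the
    -- start of the path when `a` and `b` both lie in `B`.
    obtain ⟨i, hi⟩ : ∃ i, i ∉ insert x (D ∪ B) := by
      by_contra! h
      have h1 := Finset.card_le_card (fun v _ => h v : Finset.univ ⊆ insert x (D ∪ B))
      have h2 := Finset.card_insert_le x (D ∪ B)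
      have h3 := Finset.card_union_le D B
      rw [Finset.card_univ, ← Nat.card_eq_fintype_card] at h1
      omega
    have hix : i ≠ x := fun h => hi (by simp [h])
    have hiD : i ∉ D := fun h => hi (by simp [h])
    have hiB : i ∉ B := fun h => hi (by simp [h])
    have hiy : i ≠ y := fun h => hiD (h ▸ hyD)
    have hβx : β ≠ x := fun h => hxB (h ▸ hβ)
    have hβy : β ≠ y := fun h => hyB (h ▸ hβ)
    by_cases haB : a ∈ B
    · by_cases hbB : b ∈ B
      · rcases hor i hix hiy with h | h
        · exact hpath y x i a (by simp) hiD hiB hix haB h.symm hxa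
        · exact hpath x y i b (by simp) hiD hiB hix hbB h.symm hyb
      · exact hpath y x b a (by simp) hbD hbB hbx haB hyb.symm hxa
    · by_cases hbB : b ∈ B
      · exact hpath x y a b (by simp) haD haB hax hbB hxa.symm hyb
      · rcases hor β hβx hβy with h | h
        · exact hpath x y a β (by simp) haD haB hax hβ hxa.symm h
        · exact hpath y x b β (by simp) hbD hbB hbx hβ hyb.symm h

theorem kelmans_connected {G : SimpleGraph V} (hG : G.Connected) {x y : V} (hxy : G.Adj x y) :
    (kelmans G x y).Connected := by
  have := hG.nonempty
  have hyx : (kelmans G x y).Reachable y x := ((kelmans_adj_self hxy.ne).2 hxy).reachable.symm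
  have hy : ∀ w, G.Adj y w → (kelmans G x y).Reachable y w := by
    intro w hw
    by_cases hwx : w = x
    · exact hwx ▸ hyx
    · exact ((kelmans_adj_target hxy.ne hw.ne').2 (Or.inl hw)).reachable
  have hx : ∀ w, G.Adj x w → (kelmans G x y).Reachable x w := by
    intro w hw
    by_cases hwy : w = y
    · exact hwy ▸ hyx.symm
    · exact hyx.symm.trans ((kelmans_adj_target hxy.ne hwy).2 (Or.inr hw)).reachable
  have hadj : ∀ a b, G.Adj a b → (kelmans G x y).Reachable a b := by
    intro a b hab
    by_cases hax : a = x
    · exact hax ▸ hx b (hax ▸ hab)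
    by_cases hay : a = y
    · exact hay ▸ hy b (hay ▸ hab)
    by_cases hbx : b = x
    · exact hbx ▸ (hx a (hbx ▸ hab.symm)).symm
    by_cases hby : b = y
    · exact hby ▸ (hy a (hby ▸ hab.symm)).symm
    exact ((kelmans_adj_of_ne hax hay hbx hby).2 hab).reachable
  refine ⟨fun a b => ?_⟩
  obtain ⟨p⟩ := hG.preconnected a b
  induction p with
  | nil => exact SimpleGraph.Reachable.refl _
  | cons h _ ih => exact (hadj _ _ h).trans ih

/-- If the neighbours of `y` other than `x` are neighbours of `x`, Kelmans' operation merely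
swaps `x` and `y`. -/
theorem nonempty_iso_kelmans {G : SimpleGraph V} {x y : V} (hxy : G.Adj x y)
    (h : ∀ b, G.Adj y b → b ≠ x → G.Adj x b) : Nonempty (G ≃g kelmans G x y) := by
  classical
  have hne := hxy.ne
  have hsx : ∀ w, w ≠ x → w ≠ y → ((kelmans G x y).Adj y w ↔ G.Adj x w) := by
    intro w hwx hwy
    rw [kelmans_adj_target hne hwy]
    exact ⟨fun h' => h'.elim (fun h' => h w h' hwx) id, Or.inr⟩
  have hsy : ∀ w, w ≠ x → w ≠ y → ((kelmans G x y).Adj x w ↔ G.Adj y w) := by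
    intro w hwx hwy
    rw [kelmans_adj_source hne hwx hwy]
    exact ⟨fun h' => h'.2, fun h' => ⟨h w h' hwx, h'⟩⟩
  have hself := kelmans_adj_self (G := G) hne
  refine ⟨⟨Equiv.swap x y, ?_⟩⟩
  intro a b
  by_cases hax : a = x
  · subst hax
    by_cases hba : b = a
    · simp [hba]
    by_cases hby : b = y
    · subst hby
      simpa [SimpleGraph.adj_comm] using hself
    · rw [Equiv.swap_apply_left, Equiv.swap_apply_of_ne_of_ne hba hby, hsx b hba hby]
  by_cases hay : a = y
  · subst hay
    by_cases hba : b = a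
    · simp [hba]
    by_cases hbx : b = x
    · subst hbx
      simpa [SimpleGraph.adj_comm] using hself
    · rw [Equiv.swap_apply_right, Equiv.swap_apply_of_ne_of_ne hbx hba, hsy b hbx hba]
  rw [Equiv.swap_apply_of_ne_of_ne hax hay]
  by_cases hbx : b = x
  · rw [hbx, Equiv.swap_apply_left, SimpleGraph.adj_comm, hsx a hax hay, SimpleGraph.adj_comm]
  by_cases hby : b = y
  · rw [hby, Equiv.swap_apply_right, SimpleGraph.adj_comm, hsy a hax hay, SimpleGraph.adj_comm]
  rw [Equiv.swap_apply_of_ne_of_ne hbx hby, kelmans_adj_of_ne hax hay hbx hby]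

/-! ### Descent to nested graphs and saturation -/

/-- The sum of `ρ a + ρ b` over the edges `ab` of `G`. -/
noncomputable def edgeWeight (ρ : V → ℕ) (G : SimpleGraph V) : ℕ :=
  ∑ᶠ e ∈ G.edgeSet, Sym2.lift ⟨fun a b => ρ a + ρ b, fun _ _ => add_comm _ _⟩ e

/-- Each moved edge trades the endpoint `x` for `y` of smaller rank, and the edge `xa` does move. -/
theorem edgeWeight_kelmans_lt [Finite V] {ρ : V → ℕ} {G : SimpleGraph V} {x y a : V}
    (hρ : ρ y < ρ x) (hxa : G.Adj x a) (hay : a ≠ y) (hya : ¬ G.Adj y a) :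
    edgeWeight ρ (kelmans G x y) < edgeWeight ρ G := by
  classical
  have := Fintype.ofFinite V
  set f : Sym2 V → ℕ := Sym2.lift ⟨fun a b => ρ a + ρ b, fun _ _ => add_comm _ _⟩ with hf
  set T : Finset V := Finset.univ.filter fun w => G.Adj x w ∧ w ≠ y ∧ ¬ G.Adj y w with hT
  set E : Finset (Sym2 V) := Finset.univ.filter fun e => e ∈ G.edgeSet with hE
  have hsum : ∀ z, ∑ e ∈ T.image (fun w => s(w, z)), f e = ∑ w ∈ T, (ρ w + ρ z) := by
    intro z
    rw [Finset.sum_image]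
    · rfl
    · intro w _ w' _ h
      exact Sym2.congr_left.1 h
  have hG : edgeWeight ρ G = ∑ e ∈ E, f e := by
    rw [edgeWeight, ← finsum_mem_coe_finset]
    simp [hE, hf]
  have hsub : T.image (fun w => s(w, x)) ⊆ E := by
    intro e he
    obtain ⟨w, hw, rfl⟩ := Finset.mem_image.1 he
    have hw' : G.Adj x w := (Finset.mem_filter.1 hw).2.1
    simpa [hE] using hw'.symm
  have hK : edgeWeight ρ (kelmans G x y) ≤
      ∑ e ∈ (E \ T.image (fun w => s(w, x))) ∪ T.image (fun w => s(w, y)), f e := by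
    have h1 : edgeWeight ρ (kelmans G x y) =
        ∑ e ∈ Finset.univ.filter (fun e => e ∈ (kelmans G x y).edgeSet), f e := by
      rw [edgeWeight, ← finsum_mem_coe_finset]
      simp [hf]
    rw [h1]
    apply Finset.sum_le_sum_of_subset
    intro e he
    have he' : e ∈ (kelmans G x y).edgeSet := by simpa using he
    rw [kelmans, SimpleGraph.edgeSet_fromEdgeSet] at he'
    rcases he'.1 with ⟨h2, h3⟩ | ⟨w, hw, rfl⟩
    · refine Finset.mem_union_left _ (Finset.mem_sdiff.2 ⟨by simpa [hE] using h2, fun h => h3 ?_⟩)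
      obtain ⟨w, hw, rfl⟩ := Finset.mem_image.1 h
      refine ⟨w, ?_, rfl⟩
      simpa [hT] using hw
    · refine Finset.mem_union_right _ (Finset.mem_image.2 ⟨w, ?_, rfl⟩)
      simpa [hT] using hw
  have h2 : ∑ e ∈ (E \ T.image (fun w => s(w, x))) ∪ T.image (fun w => s(w, y)), f e ≤
      ∑ e ∈ E \ T.image (fun w => s(w, x)), f e + ∑ e ∈ T.image (fun w => s(w, y)), f e := by
    rw [← Finset.sum_union_inter]
    exact Nat.le_add_right _ _
  have h3 := Finset.sum_sdiff (f := f) hsub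
  have h4 : ∑ w ∈ T, (ρ w + ρ y) < ∑ w ∈ T, (ρ w + ρ x) := by
    apply Finset.sum_lt_sum_of_nonempty
    · exact ⟨a, by simp [hT, hxa, hay, hya]⟩
    · intro w _
      omega
  rw [hsum] at h2 h3
  omega

/-- A connected graph without path on `k` vertices for which no graph that is reached from it has
a proper supergraph without path on `k` vertices. -/
def IsSaturated (k : ℕ) (G : SimpleGraph V) : Prop :=
  G.Connected ∧ ¬ HasPath G k ∧
    ∀ H H' : SimpleGraph V, Reach G H → H ≤ H' → ¬ HasPath H' k → H' = H

theorem IsSaturated.kelmans {k : ℕ} {G : SimpleGraph V} (hG : IsSaturated k G) {x y : V}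
    (hxy : G.Adj x y) : IsSaturated k (kelmans G x y) :=
  ⟨kelmans_connected hG.1 hxy, fun h => hG.2.1 (hasPath_of_kelmans hxy h), fun H H' hH =>
    hG.2.2 H H' (Relation.ReflTransGen.head
      ⟨kelmans_connected hG.1 hxy, x, y, hxy.ne, rfl⟩ hH)⟩

theorem IsSaturated.eq_wGraph [Finite V] {k : ℕ} (hkn : k ≤ Nat.card V) {ρ : V → ℕ}
    (hρ : Function.Injective ρ) (m : ℕ) : ∀ G : SimpleGraph V, edgeWeight ρ G = m →
    IsSaturated k G → ∃ D B : Finset V, Disjoint D B ∧ 1 ≤ D.card ∧ 1 ≤ B.card ∧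
      2 * D.card + B.card + 1 = k ∧ G = wGraph D B := by
  classical
  have := Fintype.ofFinite V
  induction m using Nat.strong_induction_on with
  | _ m ih =>
  intro G hm hG
  by_cases hN : IsNested ρ G
  · obtain ⟨D, B, hD, hDk, hDBk, h⟩ := hN.exists_wGraph _ V G ρ hρ hG.1 rfl k hkn hG.2.1
    -- Enlarge `B \ D` to the largest size for which the target graph still has no path on `k`
    -- vertices; saturation then forces equality.
    obtain ⟨B', hBB', hB'D, hB'c⟩ := Finset.exists_subsuperset_card_eq
      (s := B \ D) (t := Finset.univ \ D) (n := k - 1 - 2 * D.card)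
      (Finset.sdiff_subset_sdiff (Finset.subset_univ _) subset_rfl)
      ((Finset.card_le_card Finset.sdiff_subset).trans (by omega))
      (by
        rw [Finset.card_sdiff_of_subset (Finset.subset_univ _), Finset.card_univ,
          ← Nat.card_eq_fintype_card]
        omega)
    have hdis : Disjoint D B' := Finset.disjoint_right.2 fun a ha =>
      (Finset.mem_sdiff.1 (hB'D ha)).2
    have hW : ¬ HasPath (wGraph D B') k := not_hasPath_wGraph hdis (by omega) (by omega)
    have hle : wGraph D B ≤ wGraph D B' := wGraph_mono fun b hb => by
      by_cases hbD : b ∈ D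
      · exact Or.inr hbD
      · exact Or.inl (hBB' (Finset.mem_sdiff.2 ⟨hb, hbD⟩))
    refine ⟨D, B', hdis, hD, by omega, by omega, ?_⟩
    rcases h with h | ⟨H, hH, hHW⟩
    · exact (hG.2.2 G _ Relation.ReflTransGen.refl (h.trans hle) hW).symm
    · have h1 := hG.2.2 H _ hH (hHW.le.trans hle) hW
      exact absurd (hHW.trans_le hle) (h1 ▸ lt_irrefl _)
  · simp only [IsNested, not_forall] at hN
    obtain ⟨y, x, hyx, hlt, a, hay, hxa, hya⟩ := hN
    have hxy := hyx.symm
    obtain ⟨D, B, hDB, hD, hB, hk, hK⟩ := ih _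
      (hm ▸ edgeWeight_kelmans_lt hlt hxa hay hya) (KelmansExtremal.kelmans G x y) rfl
      (hG.kelmans hxy)
    by_cases hb : ∀ b, G.Adj y b → b ≠ x → G.Adj x b
    · obtain ⟨φ⟩ := nonempty_iso_kelmans hxy hb
      rw [hK] at φ
      obtain ⟨D', B', hD', hB', hdis, h⟩ := eq_wGraph_of_iso φ
      exact ⟨D', B', hdis hDB, by omega, by omega, by omega, h⟩
    · push Not at hb
      obtain ⟨b, hyb, hbx, hxb⟩ := hb
      exact absurd (hasPath_of_kelmans_eq_wGraph hxy hxa hay hya hyb hbx hxb hDB hB hK hk hkn)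
        hG.2.1

theorem Feasible.le_of_reach [Finite V] {P : GraphParameter.{u}} (hP : Feasible P)
    {G H : SimpleGraph V} (hG : G.Connected) (h : Reach G H) : P V G ≤ P V H ∧ H.Connected := by
  induction h with
  | refl => exact ⟨le_rfl, hG⟩
  | tail _ h ih =>
    obtain ⟨h1, x, y, -, rfl⟩ := h
    exact ⟨ih.1.trans (hP.le_kelmans V _ ih.2 x y), h1⟩

theorem IsExtremal.isSaturated [Finite V] {P : GraphParameter.{u}} (hP : Feasible P) {k : ℕ}
    {G : SimpleGraph V} (hG : IsExtremal P k G) : IsSaturated k G := by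
  refine ⟨hG.1.1, fun h => hG.1.2 ((pathGraph_isContained_iff k).2 h), fun H H' hH hle hH' => ?_⟩
  obtain ⟨h1, h2⟩ := hP.le_of_reach hG.1.1 hH
  by_contra hne
  obtain ⟨a, b, hab, hab'⟩ : ∃ a b, H'.Adj a b ∧ ¬ H.Adj a b := by
    by_contra! hc
    exact hne (le_antisymm (fun a b h => hc a b h) hle)
  have h3 := hP.lt_add_edge V H h2 a b hab.ne hab'
  have hle' : H ⊔ SimpleGraph.edge a b ≤ H' :=
    sup_le hle ((SimpleGraph.edge_le_iff H').2 (Or.inr hab))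
  have h4 := hG.2 (H ⊔ SimpleGraph.edge a b) (h2.mono le_sup_left)
    (fun h => hH' (((pathGraph_isContained_iff k).1 h).mono hle'))
  linarith

end KelmansExtremal

theorem theorem2p4 (P : KelmansExtremal.GraphParameter.{u}) (hP : KelmansExtremal.Feasible P)
    (n k : ℕ) (hk : 4 ≤ k) (hkn : k ≤ n)
    (V : Type u) [Finite V] (hV : Nat.card V = n)
    (G : SimpleGraph V) (hG : KelmansExtremal.IsExtremal P k G) :
    ∃ s : ℕ, 1 ≤ s ∧ s ≤ k / 2 - 1 ∧
      Nonempty (G ≃g KelmansExtremal.graphW n (k - 1) s) := by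
  -- Any enumeration of the vertices serves as the ranking. Since `B` is nonempty, `2 * D.card + 2 ≤
  -- k`, which is the bound on `s`.
  obtain ⟨D, B, hDB, hD, hB, hDBk, rfl⟩ := (hG.isSaturated hP).eq_wGraph (by omega)
    (ρ := fun v => (Finite.equivFin V v : ℕ))
    (fun a b h => (Finite.equivFin V).injective (Fin.ext h)) _ G rfl
  exact ⟨D.card, hD, by omega,
    KelmansExtremal.wGraph_iso_graphW hDB hV rfl (by omega) (by omega)⟩
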